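/- Let $\beta>1$ be a Salem number, i.e. a real algebraic integer $>1$ all of whose other Galois conjugates have modulus $\le 1$, at least one of them having modulus exactly $1$. For an integer $m\ge 2$ let $\theta_m$ be the unique root of $-1+x+x^m$ in $(0,1)$. The dynamical degree $\mathrm{dyg}(\beta)$ of a real number $1<\beta<\frac{1+\sqrt5}{2}$ is the unique integer $n\ge 3$ with $\theta_n^{-1}\le\beta<\theta_{n-1}^{-1}$ (and $\mathrm{dyg}(\frac{1+\sqrt5}{2})=2$). Let $T_\beta(x)=\{\beta x\}$ (fractional part), let $t_i=\lfloor \beta\,T_\beta^{\,i-1}(1)\rfloor$ for $i\ge1$ be the digits of the Rényi $\beta$-expansion of $1$, and let $$f_\beta(z)=-1+\sum_{i\ge 1}t_i z^i$$ be the Parry Upper function at $\beta$. Let $z_{1,n}$ be the root of $-1+X+X^n$ of smallest argument among its roots in the open upper half-plane, and let $a_{\max}=5.8743\ldots$ be the unique point of $[1,+\infty)$ at which $$a\mapsto \frac{|1-e^{\pi/a}|\,e^{-\pi/a}}{e^{\pi/a}+|1-e^{\pi/a}|}$$ reaches its maximum. Suppose that $n=\mathrm{dyg}(\beta)\ge 32$.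 Then $f_\beta$ has exactly one zero in the open disk $$\Bigl\{z\in\mathbb{C} : |z-z_{1,n}|<\frac{\pi\,|z_{1,n}|}{n\,a_{\max}}\Bigr\},$$ and this zero is simple, non-real and of modulus $<1$. -/

import Mathlib

noncomputable section

/-- A Salem number: a real algebraic integer `β > 1` all of whose other Galois conjugates have
modulus at most `1`, at least one of them having modulus exactly `1`. -/
def IsSalem (β : ℝ) : Prop :=
  1 < β ∧ IsIntegral ℤ β ∧
    (∀ z : ℂ, z ∈ (minpoly ℚ β).aroots ℂ → z ≠ (β : ℂ) → ‖z‖ ≤ 1) ∧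
    ∃ z : ℂ, z ∈ (minpoly ℚ β).aroots ℂ ∧ ‖z‖ = 1

/-- `θ_n`, the unique root of `-1 + x + x ^ n` in the open interval `(0, 1)` (`n ≥ 1`). -/
def trinomialRoot (n : ℕ) : ℝ :=
  Classical.epsilon fun x : ℝ => 0 < x ∧ x < 1 ∧ -1 + x + x ^ n = 0

/-- The dynamical degree of `β ∈ (1, (1 + √5) / 2]`: the integer `n ≥ 3` such that
`θ_n⁻¹ ≤ β < θ_{n-1}⁻¹`, and `2` for the golden ratio. The value is `0` for `β` outside
of `(1, (1 + √5) / 2]`. -/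
def dynamicalDegree (β : ℝ) : ℕ :=
  if β = Real.goldenRatio then 2
  else sInf {n : ℕ | 3 ≤ n ∧ (trinomialRoot n)⁻¹ ≤ β ∧ β < (trinomialRoot (n - 1))⁻¹}

/-- The `β`-transformation `x ↦ {β x}`. -/
def betaTransformation (β x : ℝ) : ℝ := Int.fract (β * x)

/-- The digits of the Rényi `β`-expansion of `1`, indexed from `0`:
`renyiDigit β i` is `t_{i+1} = ⌊β T_β^i(1)⌋`. -/
def renyiDigit (β : ℝ) (i : ℕ) : ℤ := ⌊β * (betaTransformation β)^[i] 1⌋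

/-- The Parry Upper function `f_β(z) = -1 + ∑_{i ≥ 1} t_i z ^ i`. Where the series does not
converge the value is `-1`, so that every zero is a zero of the sum of a convergent series. -/
def parryUpper (β : ℝ) (z : ℂ) : ℂ :=
  -1 + ∑' i : ℕ, (renyiDigit β i : ℂ) * z ^ (i + 1)

/-- `z` is the first root of `G_n(X) = -1 + X + X ^ n`: the root with the smallest argument
among the roots in the open upper half-plane. -/
def IsFirstRoot (n : ℕ) (z : ℂ) : Prop :=
  -1 + z + z ^ n = 0 ∧ 0 < z.im ∧
    ∀ w : ℂ, -1 + w + w ^ n = 0 → 0 < w.im → z.arg ≤ w.arg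

/-- `z_{1,n}`, the first root of `-1 + X + X ^ n`. It exists and is unique for `n ≥ 3`:
a nonreal root `r e^{iφ}` satisfies `r ^ (n - 1) = - sin φ / sin (n φ)`, so that its argument
determines it. -/
def firstRoot (n : ℕ) : ℂ := Classical.epsilon (IsFirstRoot n)

/-- The function `a ↦ h(1, a)`. -/
def roucheBound (a : ℝ) : ℝ :=
  |1 - Real.exp (Real.pi / a)| * Real.exp (-Real.pi / a) /
    (Real.exp (Real.pi / a) + |1 - Real.exp (Real.pi / a)|)

/-- `a_max = 5.8743…`, the point of `[1, ∞)` at which `a ↦ h(1, a)` reaches its maximum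
(attained at one point only). -/
def aMax : ℝ :=
  Classical.epsilon fun a : ℝ => 1 ≤ a ∧ IsMaxOn roucheBound (Set.Ici 1) a

end

/-! Write z = z₁(1 + v) with z₁ = z_{1,n} and |v| ≤ δ/n, where δ = π/a_max. The digits of β are 0 or
1, with t_1 = t_n = 1 and ones at least n - 1 places apart, so f_β is -1 + z + z^n plus a tail
bounded by |z|^(2n-1) / (1 - |z|^(n-1)) (`norm_parryUpper_sub_trinomial_le`). Since -1 + z₁ + z₁^n =
0, dividing f_β(z) by n z₁^n v gives z₁ / (n z₁^n) + ((1 + v)^n - 1) / (nv) + tail / (n z₁^n v).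

A direct modulus comparison is replaced by positivity of the real part of this sum on |v| = δ/n,
which already forces exactly one zero inside, and a simple one
(`existsUnique_simple_zero_of_re_pos`). With y = 1 - cos(arg v), the first term has real part at
least some t ≥ 0, the second at least 1.294 - 0.46y, and the tail term has modulus below (1.294 +
t)(1 - 0.4y). The sum is positive because 0.4 · 1.294 > 0.46.

Two inputs make this numerical. The maximum defining a_max is explicit: e^δ = 1 + √2/2
(`exp_pi_div_aMax`). And z₁ = r e^{iφ} is located through nφ = 3π/2 + γ with 0 < γ < π/2, which
gives two-sided bounds on r^n = |1 - z₁| (`firstRoot_polar`, `firstRoot_numeric`). -/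

section HalfPlane

/-! ### Counting zeros by positivity of a real part. -/

open Metric Set

/-- Minimum principle for the real part, in qualitative form. -/
lemma re_pos_of_re_pos_on_sphere {q : ℂ → ℂ} {R : ℝ} (hR : 0 < R)
    (hq : DiffContOnCl ℂ q (ball 0 R)) (hpos : ∀ v ∈ sphere (0 : ℂ) R, 0 < (q v).re)
    {v : ℂ} (hv : v ∈ ball (0 : ℂ) R) : 0 < (q v).re := by
  have hd : DiffContOnCl ℂ (fun v => Complex.exp (-q v)) (ball 0 R) :=
    Complex.differentiable_exp.comp_diffContOnCl hq.neg
  obtain ⟨w, hw, hmax⟩ := Complex.exists_mem_frontier_isMaxOn_norm isBounded_ball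
    ⟨0, mem_ball_self hR⟩ hd
  rw [frontier_ball _ hR.ne'] at hw
  have h1 : ‖Complex.exp (-q v)‖ ≤ ‖Complex.exp (-q w)‖ := hmax (subset_closure hv)
  rw [Complex.norm_exp, Complex.norm_exp, Real.exp_le_exp] at h1
  have := hpos w hw
  simp only [Complex.neg_re] at h1
  linarith

/-- If `F v / (A v)` has positive real part on the circle `|v| = R`, then `F` has exactly one zero
in the disk `|v| < R`, and it is simple. -/
theorem existsUnique_simple_zero_of_re_pos {F : ℂ → ℂ} {R : ℝ} (hR : 0 < R)
    (hF : ∀ v ∈ closedBall (0 : ℂ) R, DifferentiableAt ℂ F v) {A : ℂ} (hA : A ≠ 0)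
    (hpos : ∀ v ∈ sphere (0 : ℂ) R, 0 < (F v / (A * v)).re) :
    ∃ a ∈ ball (0 : ℂ) R, F a = 0 ∧ deriv F a ≠ 0 ∧ ∀ b ∈ ball (0 : ℂ) R, F b = 0 → b = a := by
  have hFcl : DiffContOnCl ℂ F (ball 0 R) := by
    refine ⟨fun v hv => (hF v (ball_subset_closedBall hv)).differentiableWithinAt, fun v hv => ?_⟩
    rw [closure_ball _ hR.ne'] at hv
    exact (hF v hv).continuousAt.continuousWithinAt
  have hnz : ∀ v ∈ sphere (0 : ℂ) R, v ≠ 0 := fun v hv => ne_of_mem_sphere hv hR.ne'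
  have hFs : ∀ v ∈ sphere (0 : ℂ) R, F v ≠ 0 := fun v hv h => by
    have := hpos v hv
    simp [h] at this
  obtain ⟨a, ha, hFa⟩ : ∃ a ∈ ball (0 : ℂ) R, F a = 0 := by
    by_contra! hne
    have hcl : ∀ v ∈ closure (ball (0 : ℂ) R), F v ≠ 0 := by
      intro v hv
      rw [closure_ball _ hR.ne'] at hv
      rcases (mem_closedBall.1 hv).lt_or_eq with h | h
      · exact hne v h
      · exact hFs v h
    -- If F had no zero, A v / F(v) would have positive real part on the disk, yet it vanishes at 0.
    have hq : DiffContOnCl ℂ (fun v => A * v * (F v)⁻¹) (ball 0 R) :=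
      ((differentiable_id.const_mul A).diffContOnCl).smul (hFcl.inv hcl)
    have := re_pos_of_re_pos_on_sphere hR hq (fun v hv => by
      have h := hpos v hv
      rw [← inv_inv (A * v * (F v)⁻¹), Complex.inv_re]
      have h2 : (A * v * (F v)⁻¹)⁻¹ = F v / (A * v) := by
        rw [mul_inv, inv_inv]; ring
      rw [h2]
      refine div_pos h (Complex.normSq_pos.2 fun h0 => ?_)
      simp [h0] at h) (mem_ball_self hR)
    simp at this
  have hmem : closedBall (0 : ℂ) R ∈ nhds a :=
    Filter.mem_of_superset (isOpen_ball.mem_nhds ha) ball_subset_closedBall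
  have hden : ∀ v ∈ closedBall (0 : ℂ) R, (R : ℂ) ^ 2 - (starRingEnd ℂ) a * v ≠ 0 := by
    intro v hv h
    have h1 : (R : ℂ) ^ 2 = (starRingEnd ℂ) a * v := sub_eq_zero.1 h
    have h2 := congrArg norm h1
    rw [norm_mul, norm_pow, Complex.norm_real, RCLike.norm_conj, Real.norm_of_nonneg hR.le] at h2
    rw [mem_ball_zero_iff] at ha
    rw [mem_closedBall_zero_iff] at hv
    have : ‖a‖ * ‖v‖ ≤ ‖a‖ * R := mul_le_mul_of_nonneg_left hv (norm_nonneg _)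
    nlinarith
  -- On the circle (v - a)(R² - āv) = v|v - a|², so this quotient is F(v)/(Av) times a positive
  -- real. Its real part is therefore positive inside too: the slope of F at a vanishes nowhere,
  -- which gives both simplicity and uniqueness.
  have hQ : DiffContOnCl ℂ
      (fun v => dslope F a v * (A * ((R : ℂ) ^ 2 - (starRingEnd ℂ) a * v))⁻¹) (ball 0 R) := by
    have hds : DiffContOnCl ℂ (dslope F a) (ball 0 R) := by
      constructor
      · exact (Complex.differentiableOn_dslope (isOpen_ball.mem_nhds ha)).2 hFcl.differentiableOn
      · rw [closure_ball _ hR.ne']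
        refine (continuousOn_dslope hmem).2 ⟨fun v hv => ?_, hF a (ball_subset_closedBall ha)⟩
        exact (hF v hv).continuousAt.continuousWithinAt
    refine hds.smul (DiffContOnCl.inv ?_ ?_)
    · exact Differentiable.diffContOnCl (by fun_prop)
    · intro v hv
      rw [closure_ball _ hR.ne'] at hv
      exact mul_ne_zero hA (hden v hv)
  have hre := fun v hv => re_pos_of_re_pos_on_sphere hR hQ (v := v) (fun v hv => by
    have hva : v ≠ a := by
      rintro rfl
      exact (hFs v hv) hFa
    have h3 : (v - a) * ((R : ℂ) ^ 2 - (starRingEnd ℂ) a * v) = v * ((‖v - a‖ ^ 2 : ℝ) : ℂ) := by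
      have h4 : (R : ℂ) ^ 2 = v * (starRingEnd ℂ) v := by
        rw [Complex.mul_conj, Complex.normSq_eq_norm_sq, mem_sphere_zero_iff_norm.1 hv]
        push_cast; rfl
      rw [← Complex.normSq_eq_norm_sq, ← Complex.mul_conj, h4, map_sub]
      ring
    have h5 : dslope F a v * (A * ((R : ℂ) ^ 2 - (starRingEnd ℂ) a * v))⁻¹
        = F v / (A * v) * (((‖v - a‖ ^ 2)⁻¹ : ℝ) : ℂ) := by
      rw [dslope_of_ne _ hva, slope_def_field, hFa, sub_zero, Complex.ofReal_inv]
      have h6 : ((‖v - a‖ ^ 2 : ℝ) : ℂ) ≠ 0 := by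
        have := norm_pos_iff.2 (sub_ne_zero.2 hva)
        exact_mod_cast (pow_pos this 2).ne'
      have h7 := hden v (sphere_subset_closedBall hv)
      have h8 := hnz v hv
      have h9 := sub_ne_zero.2 hva
      rw [div_mul_eq_mul_div, ← div_eq_mul_inv, ← div_eq_mul_inv, div_div, div_div,
        div_eq_div_iff (by simp_all) (by simp_all)]
      linear_combination (-(F v) * A) * h3
    rw [h5, Complex.re_mul_ofReal]
    exact mul_pos (hpos v hv) (by have := norm_pos_iff.2 (sub_ne_zero.2 hva); positivity)) hv
  refine ⟨a, ha, hFa, fun h => ?_, fun b hb hFb => ?_⟩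
  · have := hre a ha
    rw [dslope_same, h] at this
    simp at this
  · by_contra hba
    have := hre b hb
    rw [dslope_of_ne _ hba, slope_def_field, hFa, hFb] at this
    simp at this

end HalfPlane

/-! ### Digits of the Rényi expansion and the tail of the Parry Upper function. -/

section RenyiDigits

variable {β : ℝ} {n : ℕ}

lemma renyiDigit_eq_floor (β : ℝ) (i : ℕ) :
    renyiDigit β i = ⌊β * (betaTransformation β)^[i] 1⌋ := rfl

lemma iterate_betaTransformation_succ (β : ℝ) (i : ℕ) :
    (betaTransformation β)^[i + 1] 1 = β * (betaTransformation β)^[i] 1 - renyiDigit β i := by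
  rw [Function.iterate_succ_apply', renyiDigit_eq_floor, betaTransformation, Int.fract]

lemma iterate_betaTransformation_nonneg (β : ℝ) (i : ℕ) : 0 ≤ (betaTransformation β)^[i] 1 := by
  cases i with
  | zero => simp
  | succ i => rw [Function.iterate_succ_apply']; exact Int.fract_nonneg _

lemma iterate_betaTransformation_le_one (β : ℝ) (i : ℕ) : (betaTransformation β)^[i] 1 ≤ 1 := by
  cases i with
  | zero => simp
  | succ i => rw [Function.iterate_succ_apply']; exact (Int.fract_lt_one _).le

lemma lt_two_of_pow_mul_lt (h1 : 1 < β) {m : ℕ} (hlt : β ^ m * (β - 1) < 1) : β < 2 := by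
  by_contra! h
  have : 1 ≤ β ^ m := one_le_pow₀ h1.le
  nlinarith

lemma renyiDigit_eq_zero_or_one (h1 : 1 < β) (h2 : β < 2) (i : ℕ) :
    renyiDigit β i = 0 ∨ renyiDigit β i = 1 := by
  have ha := iterate_betaTransformation_nonneg β i
  have hb := iterate_betaTransformation_le_one β i
  have h3 : (0 : ℤ) ≤ renyiDigit β i := Int.floor_nonneg.2 (by positivity)
  have h4 : renyiDigit β i < 2 := by
    rw [renyiDigit_eq_floor, Int.floor_lt]
    push_cast
    nlinarith
  omega

/-- A digit 1 sends the orbit to a point at most β - 1. From there it is merely multiplied by β as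
long as it stays below 1/β, and β^(n-2)(β - 1) < 1 guarantees n - 2 zero digits. -/
lemma iterate_betaTransformation_after_one (h1 : 1 < β) (hlt : β ^ (n - 2) * (β - 1) < 1) {i : ℕ}
    (hi : renyiDigit β i = 1) (j : ℕ) (hj : j ≤ n - 2) :
    (betaTransformation β)^[i + 1 + j] 1 = β ^ j * (betaTransformation β)^[i + 1] 1 ∧
      (j < n - 2 → renyiDigit β (i + 1 + j) = 0) := by
  have hx : (betaTransformation β)^[i + 1] 1 ≤ β - 1 := by
    rw [iterate_betaTransformation_succ, hi]
    have := iterate_betaTransformation_le_one β i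
    push_cast
    nlinarith
  have hx0 := iterate_betaTransformation_nonneg β (i + 1)
  have hdigit : ∀ j, (betaTransformation β)^[i + 1 + j] 1 =
      β ^ j * (betaTransformation β)^[i + 1] 1 → j < n - 2 → renyiDigit β (i + 1 + j) = 0 := by
    intro j hj hjn
    rw [renyiDigit_eq_floor, hj, Int.floor_eq_zero_iff]
    have h0 : (0 : ℝ) < β := by linarith
    refine ⟨by positivity, ?_⟩
    have h3 : β ^ (j + 1) ≤ β ^ (n - 2) := pow_le_pow_right₀ h1.le (by omega)
    calc β * (β ^ j * (betaTransformation β)^[i + 1] 1)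
        = β ^ (j + 1) * (betaTransformation β)^[i + 1] 1 := by ring
      _ ≤ β ^ (n - 2) * (β - 1) := mul_le_mul h3 hx hx0 (by positivity)
      _ < 1 := hlt
  induction j with
  | zero => exact ⟨by simp, hdigit 0 (by simp)⟩
  | succ j ih =>
    obtain ⟨ih1, ih2⟩ := ih (by omega)
    have h : (betaTransformation β)^[i + 1 + (j + 1)] 1 =
        β ^ (j + 1) * (betaTransformation β)^[i + 1] 1 := by
      rw [← add_assoc, iterate_betaTransformation_succ, ih2 (by omega), ih1]
      push_cast
      ring
    exact ⟨h, hdigit _ h⟩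

lemma renyiDigit_zero (h1 : 1 < β) (h2 : β < 2) : renyiDigit β 0 = 1 := by
  rw [renyiDigit_eq_floor, Function.iterate_zero_apply, mul_one, Int.floor_eq_iff]
  push_cast
  constructor <;> linarith

lemma renyiDigit_sub_one (h1 : 1 < β) (h2 : β < 2) (hn : 2 ≤ n)
    (hlt : β ^ (n - 2) * (β - 1) < 1) (hle : 1 ≤ β ^ (n - 1) * (β - 1)) :
    renyiDigit β (n - 1) = 1 := by
  have h0 := renyiDigit_zero h1 h2
  obtain ⟨h, -⟩ := iterate_betaTransformation_after_one h1 hlt h0 (n - 2) le_rfl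
  have hx : (betaTransformation β)^[0 + 1] 1 = β - 1 := by
    rw [iterate_betaTransformation_succ, h0]
    simp
  rw [hx, show 0 + 1 + (n - 2) = n - 1 by omega] at h
  have h3 : (1 : ℤ) ≤ renyiDigit β (n - 1) := by
    rw [renyiDigit_eq_floor, Int.le_floor, h, ← mul_assoc, ← pow_succ',
      show n - 2 + 1 = n - 1 by omega]
    exact_mod_cast hle
  rcases renyiDigit_eq_zero_or_one h1 h2 (n - 1) with h | h <;> omega

/-- The worst case is a one at position N and then at every p-th position, a geometric series. The
induction skips one place after a 0 and p places after a 1. -/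
lemma sum_Ico_digit_mul_pow_le {d : ℕ → ℤ} (hd : ∀ i, d i = 0 ∨ d i = 1) {p : ℕ} (hp : 1 ≤ p)
    (hgap : ∀ i, d i = 1 → ∀ j, 1 ≤ j → j < p → d (i + j) = 0) {x : ℝ} (hx0 : 0 ≤ x) (hx1 : x < 1)
    (m N : ℕ) : ∑ i ∈ Finset.Ico N (N + m), (d i : ℝ) * x ^ (i + 1) ≤ x ^ (N + 1) / (1 - x ^ p) := by
  have hq : 0 < 1 - x ^ p := sub_pos.2 (pow_lt_one₀ hx0 hx1 (by omega))
  induction m using Nat.strong_induction_on generalizing N with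
  | _ m ih =>
    rcases Nat.eq_zero_or_pos m with rfl | hm
    · simp only [add_zero, Finset.Ico_self, Finset.sum_empty]
      positivity
    rcases hd N with h0 | h1
    · have h2 := ih (m - 1) (by omega) (N + 1)
      rw [show N + 1 + (m - 1) = N + m by omega] at h2
      rw [Finset.sum_eq_sum_Ico_succ_bot (by omega), h0]
      simp only [Int.cast_zero, zero_mul, zero_add]
      refine h2.trans (div_le_div_of_nonneg_right ?_ hq.le)
      exact pow_le_pow_of_le_one hx0 hx1.le (by omega)
    · have hz : ∀ k, k ≤ p → ∑ i ∈ Finset.Ico (N + 1) (N + k), (d i : ℝ) * x ^ (i + 1) = 0 := by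
        intro k hk
        refine Finset.sum_eq_zero fun i hi => ?_
        rw [Finset.mem_Ico] at hi
        have := hgap N h1 (i - N) (by omega) (by omega)
        rw [show N + (i - N) = i by omega] at this
        simp [this]
      rw [Finset.sum_eq_sum_Ico_succ_bot (by omega), h1]
      simp only [Int.cast_one, one_mul]
      rcases le_total m p with hmp | hmp
      · rw [hz m hmp, add_zero, le_div_iff₀ hq]
        have := pow_nonneg hx0 (N + 1)
        have := pow_nonneg hx0 p
        nlinarith
      · rw [← Finset.sum_Ico_consecutive _ (show N + 1 ≤ N + p by omega)
          (show N + p ≤ N + m by omega), hz p le_rfl, zero_add]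
        have h2 := ih (m - p) (by omega) (N + p)
        rw [show N + p + (m - p) = N + m by omega] at h2
        calc _ ≤ x ^ (N + 1) + x ^ (N + p + 1) / (1 - x ^ p) := by linarith
          _ = x ^ (N + 1) / (1 - x ^ p) := by
            field_simp
            ring

lemma norm_renyiDigit_mul_pow_le (h1 : 1 < β) (h2 : β < 2) (z : ℂ) (i : ℕ) :
    ‖(renyiDigit β i : ℂ) * z ^ (i + 1)‖ ≤ ‖z‖ ^ (i + 1) := by
  rcases renyiDigit_eq_zero_or_one h1 h2 i with h | h <;> simp [h]

lemma summable_renyiDigit_mul_pow (h1 : 1 < β) (h2 : β < 2) {z : ℂ} (hz : ‖z‖ < 1) :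
    Summable fun i => (renyiDigit β i : ℂ) * z ^ (i + 1) :=
  Summable.of_norm_bounded ((summable_nat_add_iff 1).2
    (summable_geometric_of_lt_one (norm_nonneg z) hz)) (norm_renyiDigit_mul_pow_le h1 h2 z)

lemma differentiableOn_parryUpper (h1 : 1 < β) (h2 : β < 2) :
    DifferentiableOn ℂ (parryUpper β) (Metric.ball 0 1) := by
  intro z hz
  rw [mem_ball_zero_iff] at hz
  obtain ⟨r, hzr, hr1⟩ := exists_between hz
  have hd : DifferentiableOn ℂ (fun z : ℂ => ∑' i : ℕ, (renyiDigit β i : ℂ) * z ^ (i + 1))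
      (Metric.ball 0 r) := by
    refine Complex.differentiableOn_tsum_of_summable_norm (u := fun i => r ^ (i + 1))
      ((summable_nat_add_iff 1).2
        (summable_geometric_of_lt_one ((norm_nonneg z).trans hzr.le) hr1)) (fun i => ?_)
      Metric.isOpen_ball fun i w hw => ?_
    · fun_prop
    · rw [mem_ball_zero_iff] at hw
      exact (norm_renyiDigit_mul_pow_le h1 h2 w i).trans
        (pow_le_pow_left₀ (norm_nonneg _) hw.le _)
  exact ((hd.differentiableAt (Metric.isOpen_ball.mem_nhds (mem_ball_zero_iff.2 hzr))).const_add
    (-1)).differentiableWithinAt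

lemma norm_parryUpper_sub_trinomial_le (h1 : 1 < β) (hn : 2 ≤ n)
    (hlt : β ^ (n - 2) * (β - 1) < 1) (hle : 1 ≤ β ^ (n - 1) * (β - 1)) {z : ℂ} (hz : ‖z‖ < 1) :
    ‖parryUpper β z - (-1 + z + z ^ n)‖ ≤ ‖z‖ ^ (2 * n - 1) / (1 - ‖z‖ ^ (n - 1)) := by
  have h2 := lt_two_of_pow_mul_lt h1 hlt
  have hs := summable_renyiDigit_mul_pow h1 h2 hz
  have hgap : ∀ i, renyiDigit β i = 1 → ∀ j, 1 ≤ j → j < n - 1 → renyiDigit β (i + j) = 0 := by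
    intro i hi j hj1 hj2
    have := (iterate_betaTransformation_after_one h1 hlt hi (j - 1) (by omega)).2 (by omega)
    rwa [show i + 1 + (j - 1) = i + j by omega] at this
  have hzero : ∀ i a b, renyiDigit β i = 1 → i < a → b ≤ i + (n - 1) →
      ∑ k ∈ Finset.Ico a b, (renyiDigit β k : ℂ) * z ^ (k + 1) = 0 := by
    intro i a b hi ha hb
    refine Finset.sum_eq_zero fun k hk => ?_
    rw [Finset.mem_Ico] at hk
    have := hgap i hi (k - i) (by omega) (by omega)
    rw [show i + (k - i) = k by omega] at this
    simp [this]
  have d0 := renyiDigit_zero h1 h2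
  have dn := renyiDigit_sub_one h1 h2 hn hlt hle
  -- Indices are shifted by one: the ones at 0 and n - 1 are t_1 and t_n, and the next possible one
  -- has index 2n - 2, which carries z^(2n-1).
  have hhead : ∑ k ∈ Finset.range (2 * n - 2), (renyiDigit β k : ℂ) * z ^ (k + 1) = z + z ^ n := by
    rw [Finset.range_eq_Ico, Finset.sum_eq_sum_Ico_succ_bot (by omega),
      ← Finset.sum_Ico_consecutive _ (show 0 + 1 ≤ n - 1 by omega)
        (show n - 1 ≤ 2 * n - 2 by omega), hzero 0 (0 + 1) (n - 1) d0 (by omega) (by omega),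
      Finset.sum_eq_sum_Ico_succ_bot (by omega),
      hzero (n - 1) (n - 1 + 1) (2 * n - 2) dn (by omega) (by omega), d0, dn,
      show n - 1 + 1 = n by omega]
    simp
  have htail : parryUpper β z - (-1 + z + z ^ n) =
      ∑' k, (renyiDigit β (k + (2 * n - 2)) : ℂ) * z ^ (k + (2 * n - 2) + 1) := by
    rw [parryUpper, ← hs.sum_add_tsum_nat_add (2 * n - 2), hhead]
    ring
  rw [htail]
  have hq : 0 < 1 - ‖z‖ ^ (n - 1) := sub_pos.2 (pow_lt_one₀ (norm_nonneg z) hz (by omega))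
  have hnn : ∀ i, (0 : ℝ) ≤ renyiDigit β i * ‖z‖ ^ (i + 1) := by
    intro i
    rcases renyiDigit_eq_zero_or_one h1 h2 i with h | h <;> rw [h] <;> simp
  have hnorm : ∀ i, ‖(renyiDigit β i : ℂ) * z ^ (i + 1)‖ = renyiDigit β i * ‖z‖ ^ (i + 1) := by
    intro i
    rcases renyiDigit_eq_zero_or_one h1 h2 i with h | h <;> simp [h]
  have hsn : Summable fun k => ‖(renyiDigit β (k + (2 * n - 2)) : ℂ) * z ^ (k + (2 * n - 2) + 1)‖ :=
    (summable_nat_add_iff (f := fun i => ‖(renyiDigit β i : ℂ) * z ^ (i + 1)‖) (2 * n - 2)).2 hs.norm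
  refine (norm_tsum_le_tsum_norm hsn).trans (hsn.tsum_le_of_sum_range_le fun m => ?_)
  have := sum_Ico_digit_mul_pow_le (renyiDigit_eq_zero_or_one h1 h2) (p := n - 1) (by omega) hgap
    (norm_nonneg z) hz m (2 * n - 2)
  rw [Finset.sum_Ico_eq_sum_range, show 2 * n - 2 + m - (2 * n - 2) = m by omega,
    show 2 * n - 2 + 1 = 2 * n - 1 by omega] at this
  refine le_trans (le_of_eq (Finset.sum_congr rfl fun k _ => ?_)) this
  rw [hnorm, add_comm k]

end RenyiDigits

/-! ### From the dynamical degree to inequalities on powers of β. -/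

lemma trinomialRoot_spec {n : ℕ} (hn : 1 ≤ n) :
    0 < trinomialRoot n ∧ trinomialRoot n < 1 ∧ -1 + trinomialRoot n + trinomialRoot n ^ n = 0 := by
  refine Classical.epsilon_spec (p := fun x : ℝ => 0 < x ∧ x < 1 ∧ -1 + x + x ^ n = 0) ?_
  have hc : ContinuousOn (fun x : ℝ => -1 + x + x ^ n) (Set.Icc 0 1) := by fun_prop
  obtain ⟨x, hx, hx0⟩ := intermediate_value_Ioo zero_le_one hc (show (0 : ℝ) ∈ _ by
    simp [show n ≠ 0 by omega])
  exact ⟨x, hx.1, hx.2, hx0⟩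

lemma pow_bounds_of_dynamicalDegree {β : ℝ} {n : ℕ} (hn : dynamicalDegree β = n) (hn3 : 3 ≤ n) :
    1 < β ∧ β ^ (n - 2) * (β - 1) < 1 ∧ 1 ≤ β ^ (n - 1) * (β - 1) := by
  have hmem : n ∈ {n : ℕ | 3 ≤ n ∧ (trinomialRoot n)⁻¹ ≤ β ∧ β < (trinomialRoot (n - 1))⁻¹} := by
    rw [dynamicalDegree] at hn
    split_ifs at hn with h
    · omega
    · rw [← hn]
      -- The infimum of an empty set would be 0, so a positive value certifies membership.
      refine Nat.sInf_mem (Nat.nonempty_of_pos_sInf ?_)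
      omega
  obtain ⟨-, hle, hlt⟩ := hmem
  obtain ⟨a0, a1, ha⟩ := trinomialRoot_spec (n := n) (by omega)
  obtain ⟨b0, b1, hb⟩ := trinomialRoot_spec (n := n - 1) (by omega)
  set a := trinomialRoot n
  set b := trinomialRoot (n - 1)
  have hβ : 1 < β := lt_of_lt_of_le ((one_lt_inv₀ a0).2 a1) hle
  have hβ0 : 0 < β := by linarith
  refine ⟨hβ, ?_, ?_⟩
  · have h1 : b < β⁻¹ := (lt_inv_comm₀ hβ0 b0).1 hlt
    have h2 : b ^ (n - 1) < β⁻¹ ^ (n - 1) := pow_lt_pow_left₀ h1 b0.le (by omega)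
    have h3 : 1 < β⁻¹ + β⁻¹ ^ (n - 1) := by linarith
    have h4 : β ^ (n - 1) * 1 < β ^ (n - 1) * (β⁻¹ + β⁻¹ ^ (n - 1)) :=
      mul_lt_mul_of_pos_left h3 (by positivity)
    have h5 : β ^ (n - 1) * (β⁻¹ + β⁻¹ ^ (n - 1)) = β ^ (n - 2) + 1 := by
      rw [mul_add, ← mul_pow, mul_inv_cancel₀ hβ0.ne', one_pow,
        show n - 1 = n - 2 + 1 by omega, pow_succ]
      field_simp
    have h6 : β ^ (n - 1) = β ^ (n - 2) * β := by rw [← pow_succ, show n - 2 + 1 = n - 1 by omega]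
    linarith
  · have h1 : β⁻¹ ≤ a := inv_le_of_inv_le₀ a0 hle
    have h2 : β⁻¹ ^ n ≤ a ^ n := pow_le_pow_left₀ (by positivity) h1 _
    have h3 : β⁻¹ + β⁻¹ ^ n ≤ 1 := by linarith
    have h4 : β ^ n * (β⁻¹ + β⁻¹ ^ n) ≤ β ^ n * 1 := mul_le_mul_of_nonneg_left h3 (by positivity)
    have h5 : β ^ n * (β⁻¹ + β⁻¹ ^ n) = β ^ (n - 1) + 1 := by
      rw [mul_add, ← mul_pow, mul_inv_cancel₀ hβ0.ne', one_pow]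
      congr 1
      rw [← pow_sub_one_mul (show n ≠ 0 by omega)]
      field_simp
    have h6 : β ^ n = β ^ (n - 1) * β := by rw [← pow_succ, show n - 1 + 1 = n by omega]
    linarith

/-! ### The constant a_max in closed form. -/

open Real in
lemma roucheBound_eq {a : ℝ} (ha : 1 ≤ a) :
    roucheBound a = (exp (π / a) - 1) / (exp (π / a) * (2 * exp (π / a) - 1)) := by
  have h1 : 1 < exp (π / a) := one_lt_exp_iff.2 (by positivity)
  rw [roucheBound, neg_div, exp_neg, abs_of_neg (by linarith), ← div_eq_mul_inv, div_div]
  congr 1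
  · ring
  · ring

/-- With t = e^{π/a}, this square shows at once that 3 - 2√2 bounds `roucheBound` and that equality
holds only at t = 1 + √2/2. -/
lemma rational_bound_sub {t : ℝ} (ht : 1 < t) :
    3 - 2 * √2 - (t - 1) / (t * (2 * t - 1)) =
      2 * (3 - 2 * √2) * (t - (1 + √2 / 2)) ^ 2 / (t * (2 * t - 1)) := by
  have h1 : t ≠ 0 := by linarith
  have h2 : 2 * t - 1 ≠ 0 := by linarith
  have h3 : √2 ^ 2 = 2 := Real.sq_sqrt (by norm_num)
  have h4 : √2 ^ 3 = 2 * √2 := by rw [pow_succ, h3]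
  field_simp
  ring_nf
  rw [h4, h3]
  ring

lemma sqrt_two_bounds : 1.414213 < √2 ∧ √2 < 1.414214 :=
  ⟨Real.lt_sqrt_of_sq_lt (by norm_num), (Real.sqrt_lt' (by norm_num)).2 (by norm_num)⟩

lemma exp_pi_div_aMax : Real.exp (Real.pi / aMax) = 1 + √2 / 2 ∧ 1 ≤ aMax := by
  obtain ⟨s1, s2⟩ := sqrt_two_bounds
  have hlog0 : 0 < Real.log (1 + √2 / 2) := Real.log_pos (by linarith)
  have hlog1 : Real.log (1 + √2 / 2) ≤ Real.pi := by
    have := Real.log_le_sub_one_of_pos (show (0 : ℝ) < 1 + √2 / 2 by linarith)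
    have := Real.pi_gt_three
    linarith
  set a₀ := Real.pi / Real.log (1 + √2 / 2) with ha₀
  have h1 : 1 ≤ a₀ := (one_le_div hlog0).2 hlog1
  have hexp : Real.exp (Real.pi / a₀) = 1 + √2 / 2 := by
    rw [ha₀, div_div_cancel₀ Real.pi_ne_zero, Real.exp_log (by linarith)]
  have hgt : ∀ a : ℝ, 1 ≤ a → 1 < Real.exp (Real.pi / a) := fun a ha =>
    Real.one_lt_exp_iff.2 (by positivity)
  have hval : roucheBound a₀ = 3 - 2 * √2 := by
    have := rational_bound_sub (hgt a₀ h1)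
    rw [← roucheBound_eq h1, hexp] at this
    simp at this
    linarith
  have hmax : IsMaxOn roucheBound (Set.Ici 1) a₀ := by
    intro a ha
    have h := rational_bound_sub (hgt a ha)
    rw [← roucheBound_eq ha] at h
    have h2 := hgt a ha
    have : 0 ≤ 2 * (3 - 2 * √2) * (Real.exp (Real.pi / a) - (1 + √2 / 2)) ^ 2 /
        (Real.exp (Real.pi / a) * (2 * Real.exp (Real.pi / a) - 1)) := by
      refine div_nonneg (mul_nonneg (by linarith) (sq_nonneg _)) (mul_nonneg ?_ ?_) <;> linarith
    simp only [Set.mem_ofPred_eq]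
    linarith
  obtain ⟨h2, h3⟩ : 1 ≤ aMax ∧ IsMaxOn roucheBound (Set.Ici 1) aMax :=
    Classical.epsilon_spec (p := fun a : ℝ => 1 ≤ a ∧ IsMaxOn roucheBound (Set.Ici 1) a)
      ⟨a₀, h1, hmax⟩
  refine ⟨?_, h2⟩
  have h4 : roucheBound a₀ ≤ roucheBound aMax := h3 h1
  have h := rational_bound_sub (hgt _ h2)
  rw [← roucheBound_eq h2] at h
  set t := Real.exp (Real.pi / aMax)
  have ht : 1 < t := hgt _ h2
  have h5 : 0 < t * (2 * t - 1) := mul_pos (by linarith) (by linarith)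
  have h6 : 2 * (3 - 2 * √2) * (t - (1 + √2 / 2)) ^ 2 ≤ 0 := by
    by_contra! h7
    have := div_pos h7 h5
    linarith
  have h8 : (t - (1 + √2 / 2)) ^ 2 ≤ 0 := by
    by_contra! h9
    have : 0 < 2 * (3 - 2 * √2) := by linarith
    nlinarith
  have := pow_eq_zero_iff (two_ne_zero) |>.1 (le_antisymm h8 (sq_nonneg _))
  linarith

lemma exp_pi_div_aMax_lt : Real.exp (Real.pi / aMax) < 1.70711 := by
  rw [exp_pi_div_aMax.1]
  have := sqrt_two_bounds.2
  linarith

lemma pi_div_aMax_bounds : 0.5347 < Real.pi / aMax ∧ Real.pi / aMax < 0.5349 := by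
  have h := exp_pi_div_aMax.1
  obtain ⟨s1, s2⟩ := sqrt_two_bounds
  constructor
  · rw [← Real.exp_lt_exp, h]
    have := Real.exp_bound' (x := 0.5347) (by norm_num) (by norm_num) (n := 8) (by norm_num)
    norm_num [Finset.sum_range_succ, Nat.factorial] at this ⊢
    linarith
  · rw [← Real.exp_lt_exp, h]
    have := Real.sum_le_exp_of_nonneg (x := 0.5349) (by norm_num) 8
    norm_num [Finset.sum_range_succ, Nat.factorial] at this ⊢
    linarith

/-! ### The first root of the trinomial in polar coordinates. -/

open Real

lemma pi_lt_d : π < 3.1416 := Real.pi_lt_d4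
lemma pi_gt_d : 3.1415 < π := Real.pi_gt_d4

lemma polar_trinomial {n : ℕ} (r φ : ℝ) :
    -1 + (r * Complex.exp (φ * Complex.I)) + (r * Complex.exp (φ * Complex.I)) ^ n = 0 ↔
      -1 + r * cos φ + r ^ n * cos (n * φ) = 0 ∧ r * sin φ + r ^ n * sin (n * φ) = 0 := by
  have h : (r * Complex.exp (φ * Complex.I)) ^ n =
      ((r ^ n : ℝ) : ℂ) * Complex.exp ((n * φ : ℝ) * Complex.I) := by
    rw [mul_pow, ← Complex.exp_nat_mul]
    push_cast
    ring_nf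
  rw [h, Complex.ext_iff]
  simp only [Complex.add_re, Complex.add_im, Complex.re_ofReal_mul, Complex.im_ofReal_mul,
    Complex.exp_ofReal_mul_I_re, Complex.exp_ofReal_mul_I_im, Complex.neg_re, Complex.neg_im,
    Complex.one_re, Complex.one_im, Complex.zero_re, Complex.zero_im, neg_zero, zero_add]

/-- The trinomial `-1 + X + X ^ n` has a root with argument in `(0, 2π / n)`. -/
lemma exists_root_arg_lt {n : ℕ} (hn : 3 ≤ n) :
    ∃ w : ℂ, -1 + w + w ^ n = 0 ∧ 0 < w.im ∧ w.arg < 2 * π / n := by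
  have hn3 : (3 : ℝ) ≤ n := by exact_mod_cast hn
  have hπ := pi_pos
  have hle : π / (n - 1) ≤ 2 * π / n := by
    rw [div_le_div_iff₀ (by linarith) (by linarith)]
    nlinarith
  -- The polar equations give r = sin(nφ)/sin((n-1)φ) and r^(n-1) = -sin φ / sin(nφ). Eliminating r
  -- leaves P(φ) = 0, and at each endpoint one of the two terms of P vanishes.
  let P : ℝ → ℝ := fun φ => (-sin (n * φ)) ^ n - sin φ * (-sin ((n - 1) * φ)) ^ (n - 1)
  have hc : ContinuousOn P (Set.Icc (π / (n - 1)) (2 * π / n)) := by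
    apply Continuous.continuousOn
    fun_prop
  have hn1 : (n : ℝ) - 1 ≠ 0 := by linarith
  have hn0 : (n : ℝ) ≠ 0 := by linarith
  have hl : 0 < P (π / (n - 1)) := by
    have h1 : (n : ℝ) * (π / (n - 1)) = π / (n - 1) + π := by field_simp; ring
    have h2 : ((n : ℝ) - 1) * (π / (n - 1)) = π := by field_simp
    simp only [P]
    rw [h1, h2, sin_add_pi, sin_pi, neg_neg, neg_zero, zero_pow (by omega), mul_zero, sub_zero]
    refine pow_pos (sin_pos_of_pos_of_lt_pi (div_pos hπ (by linarith)) ?_) _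
    rw [div_lt_iff₀ (by linarith)]
    nlinarith
  have hr : P (2 * π / n) < 0 := by
    have h1 : (n : ℝ) * (2 * π / n) = 2 * π := by field_simp
    have h2 : ((n : ℝ) - 1) * (2 * π / n) = 2 * π - 2 * π / n := by field_simp
    have h3 : 0 < sin (2 * π / n) := by
      refine sin_pos_of_pos_of_lt_pi (by positivity) ?_
      rw [div_lt_iff₀ (by linarith)]
      nlinarith
    simp only [P]
    rw [h1, h2, sin_two_pi_sub, sin_two_pi, neg_neg, neg_zero, zero_pow (by omega), zero_sub]
    have := mul_pos h3 (pow_pos h3 (n - 1))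
    linarith
  obtain ⟨φ, ⟨hφ1, hφ2⟩, hφ⟩ := intermediate_value_Ioo' hle hc ⟨hr, hl⟩
  have hφ0 : 0 < φ := lt_trans (div_pos hπ (by linarith)) hφ1
  have hφn : n * φ < 2 * π := by rwa [lt_div_iff₀' (by linarith)] at hφ2
  have hφn1 : π < (n - 1) * φ := by rwa [div_lt_iff₀' (by linarith)] at hφ1
  have hφπ : φ < π := by nlinarith
  have hs : 0 < -sin (n * φ) := by
    rw [← sin_sub_pi]
    exact sin_pos_of_pos_of_lt_pi (by linarith) (by linarith)
  have hs1 : 0 < -sin ((n - 1) * φ) := by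
    rw [← sin_sub_pi]
    exact sin_pos_of_pos_of_lt_pi (by linarith) (by linarith)
  have hsφ : 0 < sin φ := sin_pos_of_pos_of_lt_pi hφ0 hφπ
  simp only [P] at hφ
  set S := -sin (n * φ) with hS
  set S1 := -sin ((n - 1) * φ) with hS1
  have hsin : -S1 = -S * cos φ - cos (n * φ) * sin φ := by
    rw [hS1, hS, neg_neg, neg_neg, sub_mul, one_mul, sin_sub]
  have hrn : (S / S1) ^ n * S = S / S1 * sin φ := by
    have h4 : S ^ n = sin φ * S1 ^ (n - 1) := by linarith
    have h5 : S1 ^ n = S1 ^ (n - 1) * S1 := by rw [← pow_succ, show n - 1 + 1 = n by omega]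
    rw [div_pow, h5, h4]
    field_simp
  refine ⟨(S / S1 : ℝ) * Complex.exp (φ * Complex.I), ?_, ?_, ?_⟩
  · rw [polar_trinomial]
    have h6 : (S / S1) * sin φ + (S / S1) ^ n * sin (n * φ) = 0 := by
      have : sin (n * φ) = -S := by rw [hS, neg_neg]
      rw [this]
      linarith
    refine ⟨?_, h6⟩
    have h7 : (-1 + S / S1 * cos φ + (S / S1) ^ n * cos (n * φ)) * S = 0 := by
      have : (-1 + S / S1 * cos φ + (S / S1) ^ n * cos (n * φ)) * S
          = -S + S / S1 * cos φ * S + ((S / S1) ^ n * S) * cos (n * φ) := by ring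
      rw [this, hrn]
      have : S / S1 * S1 = S := div_mul_cancel₀ _ hs1.ne'
      linear_combination (S / S1) * hsin + this
    exact (mul_eq_zero.1 h7).resolve_right hs.ne'
  · rw [Complex.im_ofReal_mul, Complex.exp_ofReal_mul_I_im]
    positivity
  · rw [Complex.arg_real_mul _ (div_pos hs hs1), Complex.arg_exp_mul_I,
      (toIocMod_eq_self _).2 ⟨by linarith, by linarith⟩]
    exact hφ2

lemma isFirstRoot_firstRoot {n : ℕ} (hn : 3 ≤ n) : IsFirstRoot n (firstRoot n) := by
  refine Classical.epsilon_spec (p := IsFirstRoot n) ?_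
  obtain ⟨w, hw, hw0, -⟩ := exists_root_arg_lt hn
  have hfin : {w : ℂ | -1 + w + w ^ n = 0 ∧ 0 < w.im}.Finite := by
    let p : Polynomial ℂ := Polynomial.X ^ n + (Polynomial.X - Polynomial.C 1)
    have hp : p ≠ 0 := by
      refine (Polynomial.monic_X_pow_add ?_).ne_zero
      rw [Polynomial.degree_X_sub_C]
      exact_mod_cast (by omega : 1 < n)
    refine (Polynomial.finite_setOfPred_isRoot hp).subset fun w hw => ?_
    simp only [Set.mem_ofPred_eq, Polynomial.IsRoot, p, Polynomial.eval_add, Polynomial.eval_pow,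
      Polynomial.eval_X, Polynomial.eval_sub, Polynomial.eval_C]
    linear_combination hw.1
  obtain ⟨z, hz, hmin⟩ := Set.exists_min_image _ Complex.arg hfin ⟨w, hw, hw0⟩
  exact ⟨z, hz.1, hz.2, fun w hw hw0 => hmin w ⟨hw, hw0⟩⟩

/-- Polar coordinates of `z_{1,n}`: its argument is `(3π / 2 + γ) / n` with `γ ∈ (0, π / 2)`. -/
lemma firstRoot_polar {n : ℕ} (hn : 7 ≤ n) :
    ∃ r γ φ : ℝ, 0 < r ∧ r < 1 ∧ 0 < γ ∧ γ < π / 2 ∧ n * φ = 3 * π / 2 + γ ∧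
      firstRoot n = r * Complex.exp (φ * Complex.I) ∧
      r ^ n * sin γ = 1 - r * cos φ ∧ r ^ n * cos γ = r * sin φ := by
  obtain ⟨hz, hz0, hmin⟩ := isFirstRoot_firstRoot (n := n) (by omega)
  obtain ⟨w, hw, hw0, hwarg⟩ := exists_root_arg_lt (n := n) (by omega)
  have harg := (hmin w hw hw0).trans_lt hwarg
  set z := firstRoot n
  have hn7 : (7 : ℝ) ≤ n := by exact_mod_cast hn
  have hpi := pi_pos
  have hzne : z ≠ 0 := by
    rintro h
    simp [h] at hz0
  have hr : 0 < ‖z‖ := norm_pos_iff.2 hzne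
  have hzp : z = ‖z‖ * Complex.exp (z.arg * Complex.I) := (Complex.norm_mul_exp_arg_mul_I z).symm
  set r := ‖z‖
  set φ := z.arg
  rw [hzp, polar_trinomial] at hz
  obtain ⟨h1, h2⟩ := hz
  have hsφ : 0 < sin φ := by
    rw [hzp, Complex.im_ofReal_mul, Complex.exp_ofReal_mul_I_im] at hz0
    exact pos_of_mul_pos_right hz0 hr.le
  have hφ0 : 0 < φ := by
    by_contra! h
    have := sin_nonpos_of_nonpos_of_neg_pi_le h (Complex.neg_pi_lt_arg z).le
    linarith
  have hφn : n * φ < 2 * π := by rwa [lt_div_iff₀' (by linarith)] at harg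
  -- Here n ≥ 7 enters: 2π/7 < 0.9 keeps cos φ above 1/2, which excludes r ≥ 1 below.
  have hφ1 : φ < 0.9 := by
    have := pi_lt_d
    nlinarith
  have hrn : 0 < r ^ n := by positivity
  have hsn : sin (n * φ) < 0 := by
    have : r ^ n * sin (n * φ) < 0 := by nlinarith
    exact neg_of_mul_neg_right this hrn.le
  have hnφ : π < n * φ := by
    by_contra! h
    have := sin_nonneg_of_nonneg_of_le_pi (by positivity) h
    linarith
  have hsq : (r ^ n) ^ 2 = 1 - 2 * r * cos φ + r ^ 2 := by
    have e1 := sin_sq_add_cos_sq φ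
    have e2 := sin_sq_add_cos_sq (n * φ)
    have h3 : r ^ n * cos (n * φ) = 1 - r * cos φ := by linarith
    have h4 : r ^ n * sin (n * φ) = -(r * sin φ) := by linarith
    calc (r ^ n) ^ 2 = (r ^ n * cos (n * φ)) ^ 2 + (r ^ n * sin (n * φ)) ^ 2 := by
          linear_combination (-(r ^ n) ^ 2) * e2
      _ = _ := by rw [h3, h4]; linear_combination r ^ 2 * e1
  have hcos : 0.59 < cos φ := by
    have := one_sub_sq_div_two_le_cos (x := φ)
    nlinarith
  -- If r ≥ 1 then r² ≤ r^(2n) = |1 - z|² = 1 - 2r cos φ + r², so 2r cos φ ≤ 1.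
  have hr1 : r < 1 := by
    by_contra! h
    have h3 : r ≤ r ^ n := le_self_pow₀ h (by omega)
    have h4 : r ^ 2 ≤ (r ^ n) ^ 2 := pow_le_pow_left₀ hr.le h3 2
    nlinarith
  have hcn : 0 < cos (n * φ) := by
    have h3 : r ^ n * cos (n * φ) = 1 - r * cos φ := by linarith
    have h4 : r * cos φ < 1 := by nlinarith [cos_le_one φ]
    exact pos_of_mul_pos_right (by linarith) hrn.le
  have hγ0 : 3 * π / 2 < n * φ := by
    by_contra! h
    have := cos_nonpos_of_pi_div_two_le_of_le (x := n * φ) (by linarith) (by linarith)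
    linarith
  have hγ : n * φ = 3 * π / 2 + (n * φ - 3 * π / 2) := by ring
  have hnφ' : n * φ = (n * φ - 3 * π / 2) - π / 2 + 2 * π := by ring
  refine ⟨r, n * φ - 3 * π / 2, φ, hr, hr1, by linarith, by linarith, hγ, hzp, ?_, ?_⟩
  · rw [hnφ', cos_add_two_pi, cos_sub_pi_div_two] at h1
    linarith
  · rw [hnφ', sin_add_two_pi, sin_sub_pi_div_two] at h2
    linarith

/-! ### Numerical bounds on r, r^n and γ. -/

section PolarBounds

variable {n : ℕ} {r γ φ : ℝ}

lemma sq_pow_eq (h1 : r ^ n * sin γ = 1 - r * cos φ) (h2 : r ^ n * cos γ = r * sin φ) :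
    (r ^ n) ^ 2 = 1 - 2 * r * cos φ + r ^ 2 := by
  calc (r ^ n) ^ 2 = (r ^ n * sin γ) ^ 2 + (r ^ n * cos γ) ^ 2 := by
        linear_combination (-(r ^ n) ^ 2) * sin_sq_add_cos_sq γ
    _ = _ := by rw [h1, h2]; linear_combination r ^ 2 * sin_sq_add_cos_sq φ

lemma sin_phi_lower (hn : 32 ≤ n) (hγ0 : 0 < γ) (hγ : γ < π / 2)
    (hφ : n * φ = 3 * π / 2 + γ) : 4.68 ≤ n * sin φ := by
  have hn32 : (32 : ℝ) ≤ n := by exact_mod_cast hn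
  have := pi_lt_d
  have := pi_gt_d
  have hφ0 : 0 ≤ φ := by
    by_contra! h
    nlinarith
  have hφ1 : φ ≤ 0.1964 := by
    by_contra! h
    nlinarith
  have h1 := sin_ge_sub_cube hφ0
  have h2 : φ * 0.9935 ≤ sin φ := by
    have : φ ^ 2 ≤ 0.1964 ^ 2 := pow_le_pow_left₀ hφ0 hφ1 2
    nlinarith
  nlinarith

/-- r^n = |1 - z₁| is at least the distance sin φ from 1 to the line through 0 and z₁. -/
lemma pow_lower (hn : 32 ≤ n) (hr0 : 0 < r) (hγ0 : 0 < γ) (hγ : γ < π / 2)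
    (hφ : n * φ = 3 * π / 2 + γ)
    (h1 : r ^ n * sin γ = 1 - r * cos φ) (h2 : r ^ n * cos γ = r * sin φ) :
    4.68 ≤ n * r ^ n := by
  have hn32 : (32 : ℝ) ≤ n := by exact_mod_cast hn
  have h3 := sin_phi_lower hn hγ0 hγ hφ
  refine h3.trans (mul_le_mul_of_nonneg_left ?_ (by positivity))
  refine le_of_sq_le_sq ?_ (by positivity)
  rw [sq_pow_eq h1 h2]
  nlinarith [sin_sq_add_cos_sq φ, sq_nonneg (r - cos φ)]

/-- One bootstrap step: sin γ = (1 - r cos φ)/r^n, so a bound on φ bounds γ, which in turn improves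
the bound on φ = (3π/2 + γ)/n. -/
lemma gamma_le_of_bounds {r₀ κ₀ Φ G : ℝ} (hr₀ : 0 ≤ r₀) (hr : r₀ ≤ r) (hκ₀ : 0 < κ₀)
    (hκ : κ₀ ≤ r ^ n) (hφ0 : 0 ≤ φ) (hφ : φ ≤ Φ) (hΦ : Φ ≤ 1) (hG : 0 ≤ G) (hγ : γ < π / 2)
    (h1 : r ^ n * sin γ = 1 - r * cos φ)
    (hb : 1 - r₀ * (1 - Φ ^ 2 / 2) ≤ κ₀ * (G - G ^ 3 / 6)) : γ ≤ G := by
  by_contra! h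
  have h3 : sin G < sin γ := sin_lt_sin_of_lt_of_le_pi_div_two (by linarith [pi_pos]) hγ.le h
  have h4 := sin_ge_sub_cube hG
  have h5 : 1 - Φ ^ 2 / 2 ≤ cos φ := by
    have := one_sub_sq_div_two_le_cos (x := φ)
    nlinarith
  have h6 : r₀ * (1 - Φ ^ 2 / 2) ≤ r * cos φ :=
    mul_le_mul hr h5 (by nlinarith) (by linarith)
  have h7 : κ₀ * (G - G ^ 3 / 6) ≤ κ₀ * sin G := mul_le_mul_of_nonneg_left h4 hκ₀.le
  have h8 : κ₀ * sin G < κ₀ * sin γ := mul_lt_mul_of_pos_left h3 hκ₀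
  have h9 : 0 ≤ sin γ := by
    have : 0 ≤ sin G := sin_nonneg_of_nonneg_of_le_pi hG (by linarith)
    linarith
  have : κ₀ * sin γ ≤ r ^ n * sin γ := mul_le_mul_of_nonneg_right hκ h9
  linarith

lemma pow_le_of_bounds {r₀ κ₀ Φ : ℝ} (hr : r₀ ≤ r) (hr0 : 0 ≤ r) (hr1 : r ≤ 1) (hκ₀ : 0 ≤ κ₀)
    (hφ0 : 0 ≤ φ) (hφ : φ ≤ Φ) (hΦ : Φ ^ 2 ≤ 1 - r₀)
    (h1 : r ^ n * sin γ = 1 - r * cos φ) (h2 : r ^ n * cos γ = r * sin φ)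
    (hb : (1 - r₀) ^ 2 + r₀ * Φ ^ 2 ≤ κ₀ ^ 2) : r ^ n ≤ κ₀ := by
  refine le_of_sq_le_sq ?_ hκ₀
  rw [sq_pow_eq h1 h2]
  have h5 : 1 - Φ ^ 2 / 2 ≤ cos φ := by
    have := one_sub_sq_div_two_le_cos (x := φ)
    nlinarith
  have h6 : r * (1 - Φ ^ 2 / 2) ≤ r * cos φ := mul_le_mul_of_nonneg_left h5 hr0
  have h7 : 0 ≤ (r - r₀) * (2 - r - r₀ - Φ ^ 2) := mul_nonneg (by linarith) (by linarith)
  nlinarith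

lemma le_of_pow_le_of_lt {r₀ κ₀ : ℝ} (hr0 : 0 ≤ r) (hr₀ : r₀ ^ n ≤ κ₀) (hκ : κ₀ < r ^ n) :
    r₀ ≤ r := by
  by_contra! h
  have := pow_le_pow_left₀ hr0 h.le n
  linarith

lemma mul_pow_le_of_ge {n : ℕ} (hn : 32 ≤ n) : n * (0.94 : ℝ) ^ n ≤ 4.6 := by
  induction n, hn using Nat.le_induction with
  | base => norm_num
  | succ m hm ih =>
    have hm32 : (32 : ℝ) ≤ m := by exact_mod_cast hm
    have : (0 : ℝ) < 0.94 ^ m := by positivity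
    rw [pow_succ]
    push_cast
    nlinarith

lemma r_lower (hr0 : 0 < r) (hn : 32 ≤ n) (hlow : 4.68 ≤ n * r ^ n) : 0.94 ≤ r := by
  by_contra! h
  have h1 := mul_pow_le_of_ge hn
  have h2 : r ^ n ≤ 0.94 ^ n := pow_le_pow_left₀ hr0.le h.le n
  have : n * r ^ n ≤ n * 0.94 ^ n := mul_le_mul_of_nonneg_left h2 (by positivity)
  linarith

/-- A larger r^n would force r close to 1, hence γ and φ small, hence |1 - z₁| = r^n small. The
successive values of Φ are 2π/32 and then (3π/2 + G)/32 for the bound G just obtained, rounded up.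
-/
lemma pow_upper_32 (hr0 : 0 < r) (hr1 : r < 1) (hγ0 : 0 < γ) (hγ : γ < π / 2)
    (hφ : 32 * φ = 3 * π / 2 + γ)
    (h1 : r ^ 32 * sin γ = 1 - r * cos φ) (h2 : r ^ 32 * cos γ = r * sin φ) : r ^ 32 ≤ 0.166 := by
  by_contra! hκ
  have hr : 0.9454 ≤ r := le_of_pow_le_of_lt hr0.le (by norm_num) hκ
  have := pi_lt_d
  have := pi_pos
  have hφ0 : 0 ≤ φ := by linarith
  have g1 : γ ≤ 0.4545 := gamma_le_of_bounds (Φ := 0.19635) (by norm_num) hr (by norm_num) hκ.le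
    hφ0 (by linarith) (by norm_num) (by norm_num) hγ h1 (by norm_num)
  have g2 : γ ≤ 0.4154 := gamma_le_of_bounds (Φ := 0.16147) (by norm_num) hr (by norm_num) hκ.le
    hφ0 (by linarith) (by norm_num) (by norm_num) hγ h1 (by norm_num)
  have := pow_le_of_bounds (κ₀ := 0.166) (Φ := 0.16025) hr hr0.le hr1.le (by norm_num) hφ0
    (by linarith) (by norm_num) h1 h2 (by norm_num)
  linarith

lemma pow_upper_33 (hr0 : 0 < r) (hr1 : r < 1) (hγ0 : 0 < γ) (hγ : γ < π / 2)
    (hφ : 33 * φ = 3 * π / 2 + γ)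
    (h1 : r ^ 33 * sin γ = 1 - r * cos φ) (h2 : r ^ 33 * cos γ = r * sin φ) : r ^ 33 ≤ 0.1615 := by
  by_contra! hκ
  have hr : 0.9462 ≤ r := le_of_pow_le_of_lt hr0.le (by norm_num) hκ
  have := pi_lt_d
  have := pi_pos
  have hφ0 : 0 ≤ φ := by linarith
  have g1 : γ ≤ 0.456 := gamma_le_of_bounds (Φ := 0.1905) (by norm_num) hr (by norm_num) hκ.le
    hφ0 (by linarith) (by norm_num) (by norm_num) hγ h1 (by norm_num)
  have g2 : γ ≤ 0.418 := gamma_le_of_bounds (Φ := 0.15665) (by norm_num) hr (by norm_num) hκ.le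
    hφ0 (by linarith) (by norm_num) (by norm_num) hγ h1 (by norm_num)
  have := pow_le_of_bounds (κ₀ := 0.1615) (Φ := 0.1555) hr hr0.le hr1.le (by norm_num) hφ0
    (by linarith) (by norm_num) h1 h2 (by norm_num)
  linarith

lemma exp_neg_bound : exp (-1.845) ≤ 0.1585 := by
  have := sum_le_exp_of_nonneg (x := 1.845) (by norm_num) 10
  rw [exp_neg]
  refine inv_le_of_inv_le₀ (by norm_num) (le_trans ?_ this)
  norm_num [Finset.sum_range_succ, Nat.factorial]

lemma pow_upper_of_ge (hn : 34 ≤ n) (hr0 : 0 < r) (hr1 : r < 1) (hγ0 : 0 < γ) (hγ : γ < π / 2)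
    (hφ : n * φ = 3 * π / 2 + γ)
    (h1 : r ^ n * sin γ = 1 - r * cos φ) (h2 : r ^ n * cos γ = r * sin φ) : r ^ n ≤ 0.1585 := by
  by_contra! hκ
  have hn34 : (34 : ℝ) ≤ n := by exact_mod_cast hn
  have hn0 : (n : ℝ) ≠ 0 := by linarith
  obtain ⟨m, hm⟩ : ∃ m : ℝ, m = (n : ℝ)⁻¹ := ⟨_, rfl⟩
  have hm0 : 0 < m := by rw [hm]; positivity
  have hm1 : m ≤ 1 / 34 := by
    rw [hm, one_div]
    exact inv_anti₀ (by norm_num) hn34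
  have hr : 1 - 1.845 * m ≤ r := by
    refine le_of_pow_le_of_lt hr0.le ?_ hκ
    refine le_trans ?_ exp_neg_bound
    have h3 : 1 - 1.845 * m ≤ exp (-1.845 * m) := by
      have := add_one_le_exp (-1.845 * m)
      linarith
    refine (pow_le_pow_left₀ (by linarith) h3 n).trans (le_of_eq ?_)
    rw [← exp_nat_mul, hm]
    congr 1
    field_simp
  have hφm : φ = (3 * π / 2 + γ) * m := by
    rw [← hφ, hm]
    field_simp
  have := pi_lt_d
  have := pi_pos
  have hφ0 : 0 ≤ φ := by rw [hφm]; positivity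
  have g1 : γ ≤ 0.4615 := by
    refine gamma_le_of_bounds (Φ := 6.2832 * m) (by linarith) hr (by norm_num) hκ.le
      hφ0 ?_ (by linarith) (by norm_num) hγ h1 ?_
    · rw [hφm]
      exact mul_le_mul_of_nonneg_right (by linarith) hm0.le
    · have h3 : m ^ 2 ≤ 1 / 34 * m := by nlinarith
      have h4 : m ^ 3 ≤ 1 / 34 * m ^ 2 := by nlinarith [sq_nonneg m]
      nlinarith
  have := pow_le_of_bounds (κ₀ := 0.1585) (Φ := 5.174 * m) hr hr0.le hr1.le (by norm_num) hφ0
    (by rw [hφm]; exact mul_le_mul_of_nonneg_right (by linarith) hm0.le)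
    (by nlinarith) h1 h2 (by
      have h3 : 0 ≤ (1 / 34 - m) * (1 / 34 + m) := mul_nonneg (by linarith) (by linarith)
      have h4 : 0 ≤ (1 / 34 - m) * m ^ 2 := mul_nonneg (by linarith) (sq_nonneg m)
      nlinarith)
  linarith

/-- The numerical inequality between the data of `z_{1,n}` behind the Rouché-type estimate. -/
lemma firstRoot_numeric (hn : 32 ≤ n) (hr0 : 0 < r) (hr1 : r < 1) (hγ0 : 0 < γ) (hγ : γ < π / 2)
    (hφ : n * φ = 3 * π / 2 + γ)
    (h1 : r ^ n * sin γ = 1 - r * cos φ) (h2 : r ^ n * cos γ = r * sin φ)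
    {δ : ℝ} (hδ1 : 0.5347 < δ) (hδ2 : δ < 0.5349) (hδe : exp δ < 1.70711) :
    r ^ n ≤ 0.166 ∧ (1 + δ / n) ^ n ≤ 1.70711 ∧
    0 < r * (1 + δ / n) - r ^ n * (1 + δ / n) ^ n ∧
    ∃ t, 0 ≤ t ∧ t ≤ r * (cos φ - r) / (n * (r ^ n) ^ 2) ∧
      r ^ n * ((1 + δ / n) ^ n) ^ 2 <
        (1.294 + t) * (δ * (r * (1 + δ / n) - r ^ n * (1 + δ / n) ^ n)) := by
  have hlow := pow_lower hn hr0 hγ0 hγ hφ h1 h2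
  have hr94 := r_lower hr0 hn hlow
  have hn32 : (32 : ℝ) ≤ n := by exact_mod_cast hn
  have hn0 : (n : ℝ) ≠ 0 := by linarith
  have hpi := pi_lt_d
  have hpi0 := pi_pos
  have hφ0 : 0 ≤ φ := by
    by_contra! h
    nlinarith
  have hE0 : 0 < (1 + δ / n) ^ n := by positivity
  have hE : (1 + δ / n) ^ n ≤ 1.70711 := by
    refine le_trans ?_ hδe.le
    have h3 : 1 + δ / n ≤ exp (δ / n) := by
      have := add_one_le_exp (δ / n)
      linarith
    refine (pow_le_pow_left₀ (by positivity) h3 n).trans (le_of_eq ?_)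
    rw [← exp_nat_mul]
    congr 1
    field_simp
  have hκ0 : 0 < r ^ n := by positivity
  have hδn : 0 < δ / n := by positivity
  -- The inequality is monotone in each quantity, so it reduces to a check at numerical bounds.
  have key : ∀ κ₀ r₀ E₀ ρ₀ t : ℝ, r ^ n ≤ κ₀ → r₀ ≤ r → 0 ≤ r₀ → (1 + δ / n) ^ n ≤ E₀ →
      ρ₀ ≤ 1 + δ / n → 0 ≤ t → 0 < r₀ * ρ₀ - κ₀ * E₀ →
      κ₀ * E₀ ^ 2 < (1.294 + t) * (0.5347 * (r₀ * ρ₀ - κ₀ * E₀)) →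
      0 < r * (1 + δ / n) - r ^ n * (1 + δ / n) ^ n ∧ r ^ n * ((1 + δ / n) ^ n) ^ 2 <
        (1.294 + t) * (δ * (r * (1 + δ / n) - r ^ n * (1 + δ / n) ^ n)) := by
    intro κ₀ r₀ E₀ ρ₀ t a1 a2 a3 a4 a5 a6 a7 a8
    have b1 : r ^ n * (1 + δ / n) ^ n ≤ κ₀ * E₀ := mul_le_mul a1 a4 hE0.le (hκ0.le.trans a1)
    have b2 : r₀ * ρ₀ ≤ r * (1 + δ / n) :=
      (mul_le_mul_of_nonneg_left a5 a3).trans (mul_le_mul_of_nonneg_right a2 (by linarith))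
    have b3 : r ^ n * ((1 + δ / n) ^ n) ^ 2 ≤ κ₀ * E₀ ^ 2 :=
      mul_le_mul a1 (pow_le_pow_left₀ hE0.le a4 2) (by positivity) (hκ0.le.trans a1)
    have b4 : 0.5347 * (r₀ * ρ₀ - κ₀ * E₀) ≤
        δ * (r * (1 + δ / n) - r ^ n * (1 + δ / n) ^ n) :=
      mul_le_mul hδ1.le (by linarith) a7.le (by linarith)
    exact ⟨by linarith, lt_of_le_of_lt b3 (a8.trans_le
      (mul_le_mul_of_nonneg_left b4 (by linarith)))⟩
  have hterm : r ^ n ≤ 0.166 → 0 ≤ r * (cos φ - r) / (n * (r ^ n) ^ 2) := by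
    intro hκ
    have hφ2 : φ ≤ 6.2832 / n := by
      rw [le_div_iff₀ (by linarith)]
      linarith
    have hc : 1 - 19.74 / n / n ≤ cos φ := by
      have h3 := one_sub_sq_div_two_le_cos (x := φ)
      have h4 : φ ^ 2 ≤ (6.2832 / n) ^ 2 := pow_le_pow_left₀ hφ0 hφ2 2
      have h5 : (6.2832 / (n : ℝ)) ^ 2 = 39.47860224 / n / n := by field_simp; norm_num
      have h6 : 39.47860224 / (n : ℝ) / n ≤ 2 * (19.74 / n / n) := by
        rw [← mul_div_assoc, ← mul_div_assoc]
        gcongr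
        norm_num
      linarith
    have h7 : 19.74 / (n : ℝ) ≤ 0.7 := by
      rw [div_le_iff₀ (by linarith)]
      linarith
    have h8 : 19.74 / (n : ℝ) / n ≤ 1 := by
      rw [div_le_iff₀ (by linarith)]
      linarith
    -- Since cos φ ≥ 1 - 19.74/n² (19.74 ≈ 2π²), r > cos φ would give r^n ≥ 1 - 19.74/n ≥ 0.3.
    have hrc : r ≤ cos φ := by
      by_contra! h
      have h9 : (1 - 19.74 / n / n : ℝ) ^ n ≤ r ^ n :=
        pow_le_pow_left₀ (by linarith) (hc.trans h.le) n
      have h10 := one_add_mul_le_pow (show (-2 : ℝ) ≤ -(19.74 / n / n) by linarith) n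
      have h11 : (n : ℝ) * -(19.74 / n / n) = -(19.74 / n) := by field_simp
      rw [h11, ← sub_eq_add_neg, ← sub_eq_add_neg] at h10
      linarith
    exact div_nonneg (mul_nonneg hr0.le (by linarith)) (by positivity)
  rcases Nat.lt_or_ge n 34 with hlt | hge
  · obtain rfl | rfl : n = 32 ∨ n = 33 := by omega
    · push_cast at *
      have hκ := pow_upper_32 hr0 hr1 hγ0 hγ hφ h1 h2
      have hr : 0.9415 ≤ r := le_of_pow_le_of_lt (n := 32) (κ₀ := 0.1455) hr0.le (by norm_num)
        (by linarith)
      have hru : r ≤ 0.9455 := by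
        by_contra! h
        have := pow_le_pow_left₀ (by norm_num) h.le 32
        norm_num at this
        linarith
      have g1 : γ ≤ 0.553 := gamma_le_of_bounds (n := 32) (κ₀ := 0.14625) (Φ := 0.19635)
        (by norm_num) hr (by norm_num) (by linarith) hφ0 (by linarith) (by norm_num)
        (by norm_num) hγ h1 (by norm_num)
      have hcos : 0.9864 ≤ cos φ := by
        have h3 := one_sub_sq_div_two_le_cos (x := φ)
        have h4 : φ ^ 2 ≤ 0.16455 ^ 2 := pow_le_pow_left₀ hφ0 (by linarith) 2
        norm_num at h4 ⊢
        linarith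
      have hE32 : (1 + δ / 32) ^ 32 ≤ 1.6998 :=
        (pow_le_pow_left₀ (by positivity) (show 1 + δ / 32 ≤ 1 + 0.5349 / 32 by linarith) 32).trans
          (by norm_num)
      -- At n = 32 these bounds do not suffice with t = 0, nor with 1.70711 in place of 1.6998. For
      -- larger n, t = 0 is enough.
      obtain ⟨c1, c2⟩ := key 0.166 0.9415 1.6998 1.0167 0.043 hκ hr (by norm_num) hE32
        (by linarith) (by norm_num) (by norm_num) (by norm_num)
      refine ⟨hκ, hE, c1, 0.043, by norm_num, ?_, c2⟩
      rw [le_div_iff₀ (by positivity)]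
      have h5 : (r ^ 32) ^ 2 ≤ 0.166 ^ 2 := pow_le_pow_left₀ hκ0.le hκ 2
      have h6 : 0.9415 * (0.9864 - 0.9455) ≤ r * (cos φ - r) :=
        mul_le_mul hr (by linarith) (by norm_num) hr0.le
      norm_num at h5 h6 ⊢
      linarith
    · push_cast at *
      have hκ := pow_upper_33 hr0 hr1 hγ0 hγ hφ h1 h2
      have hr : 0.942 ≤ r := le_of_pow_le_of_lt (n := 33) (κ₀ := 0.1415) hr0.le (by norm_num)
        (by linarith)
      obtain ⟨c1, c2⟩ := key 0.1615 0.942 1.70711 1.0162 0 hκ hr (by norm_num) hE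
        (by linarith) le_rfl (by norm_num) (by norm_num)
      exact ⟨by linarith, hE, c1, 0, le_rfl, hterm (by linarith), c2⟩
  · have hκ := pow_upper_of_ge hge hr0 hr1 hγ0 hγ hφ h1 h2
    obtain ⟨c1, c2⟩ := key 0.1585 0.94 1.70711 1 0 hκ hr94 (by norm_num) hE
      (by linarith) le_rfl (by norm_num) (by norm_num)
    exact ⟨by linarith, hE, c1, 0, le_rfl, hterm (by linarith), c2⟩

end PolarBounds

/-! ### Estimates on the circle |v| = δ/n. -/

lemma cast_choose_three (n : ℕ) : (n.choose 3 : ℂ) = n * (n - 1) * (n - 2) / 6 := by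
  rcases Nat.lt_or_ge n 2 with h | h
  · interval_cases n <;> simp [Nat.choose]
  · have h1 := congrArg (Nat.cast : ℕ → ℂ) (Nat.choose_succ_right_eq n 2)
    push_cast [Nat.cast_sub h, Nat.cast_choose_two] at h1
    linear_combination h1 / 3

/-- Third order Taylor estimate for `(1 + v) ^ n`, uniform in `n` at fixed `n ‖v‖`. -/
lemma norm_one_add_pow_sub_le {n : ℕ} (hn : 3 ≤ n) (v : ℂ) :
    ‖(1 + v) ^ n - (1 + n * v + n * (n - 1) / 2 * v ^ 2 + n * (n - 1) * (n - 2) / 6 * v ^ 3)‖ ≤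
      exp (n * ‖v‖) -
        (1 + n * ‖v‖ + (n * ‖v‖) ^ 2 / 2 + (n * ‖v‖) ^ 3 / 6) := by
  have h1 : (1 + v) ^ n - (1 + n * v + n * (n - 1) / 2 * v ^ 2 + n * (n - 1) * (n - 2) / 6 * v ^ 3)
      = ∑ k ∈ Finset.Ico 4 (n + 1), v ^ k * (n.choose k : ℂ) := by
    rw [add_comm, add_pow, Finset.sum_Ico_eq_sub _ (by omega)]
    simp only [one_pow, mul_one, Finset.sum_range_succ _ 3, Finset.sum_range_succ _ 2,
      Finset.sum_range_succ _ 1, Finset.sum_range_one, cast_choose_three, Nat.cast_choose_two,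
      Nat.choose_zero_right, Nat.choose_one_right, pow_zero, pow_one, Nat.cast_one]
    ring
  have h2 := sum_le_exp_of_nonneg (x := n * ‖v‖) (by positivity) (n + 1)
  have h3 : ∑ k ∈ Finset.Ico 4 (n + 1), (n * ‖v‖) ^ k / (k.factorial : ℝ) ≤ exp (n * ‖v‖) -
      (1 + n * ‖v‖ + (n * ‖v‖) ^ 2 / 2 + (n * ‖v‖) ^ 3 / 6) := by
    rw [Finset.sum_Ico_eq_sub _ (by omega)]
    refine (sub_le_sub_right h2 _).trans (le_of_eq ?_)
    norm_num [Finset.sum_range_succ, Nat.factorial]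
  rw [h1]
  refine (norm_sum_le _ _).trans (le_trans (Finset.sum_le_sum fun k _ => ?_) h3)
  rw [norm_mul, norm_pow, Complex.norm_natCast, mul_pow, mul_comm, mul_div_right_comm]
  exact mul_le_mul_of_nonneg_right (Nat.choose_le_pow_div k n) (by positivity)

section Circle

variable {n : ℕ} {δ : ℝ} {v : ℂ}

/-- On the circle `‖v‖ = δ / n`, with `y = 1 - cos (arg v)`. -/
lemma re_one_add_pow_sub_one_div (hn : 32 ≤ n) (hδ1 : 0.5347 < δ) (hδ2 : δ < 0.5349)
    (hδe : exp δ < 1.70711) (hv : ‖v‖ = δ / n) {y : ℝ} (hy0 : 0 ≤ y)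
    (hre : n * v.re = δ * (1 - y)) :
    1.294 - 0.46 * y ≤ (((1 + v) ^ n - 1) / (n * v)).re := by
  have hn32 : (32 : ℝ) ≤ n := by exact_mod_cast hn
  have hn0 : (n : ℝ) ≠ 0 := by linarith
  have hnC : (n : ℂ) ≠ 0 := by exact_mod_cast hn0
  have hnv : n * ‖v‖ = δ := by rw [hv]; field_simp
  have hδ0 : 0 < δ := by linarith
  have hvne : v ≠ 0 := by
    rintro rfl
    simp at hnv
    linarith
  obtain ⟨m, hm⟩ : ∃ m : ℝ, m = (n : ℝ)⁻¹ := ⟨_, rfl⟩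
  have hm0 : 0 < m := by rw [hm]; positivity
  have hm1 : m ≤ 1 / 32 := by
    rw [hm, one_div]
    exact inv_anti₀ (by norm_num) hn32
  have hT := norm_one_add_pow_sub_le (n := n) (by omega) v
  rw [hnv] at hT
  set R := (1 + v) ^ n -
    (1 + n * v + n * (n - 1) / 2 * v ^ 2 + n * (n - 1) * (n - 2) / 6 * v ^ 3) with hR
  have hRb : ‖R / (n * v)‖ ≤ 0.0075 := by
    rw [norm_div, norm_mul, Complex.norm_natCast, hnv, div_le_iff₀ hδ0]
    nlinarith [pow_le_pow_left₀ (by norm_num) hδ1.le 3, pow_le_pow_left₀ (by norm_num) hδ1.le 2]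
  have hdecomp : ((1 + v) ^ n - 1) / (n * v) = 1 + (((1 - m) / 2 : ℝ) : ℂ) * (n * v) +
      (((1 - m) * (1 - 2 * m) / 6 : ℝ) : ℂ) * (n * v) ^ 2 + R / (n * v) := by
    rw [hR, hm]
    push_cast
    field_simp
    ring
  have hu : ((n : ℂ) * v).re = δ * (1 - y) := by
    rw [← Complex.ofReal_natCast, Complex.re_ofReal_mul, hre]
  have hu2 : (((n : ℂ) * v) ^ 2).re = δ ^ 2 * (1 - 4 * y + 2 * y ^ 2) := by
    have h1 : ((n : ℂ) * v).re ^ 2 + ((n : ℂ) * v).im ^ 2 = δ ^ 2 := by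
      have := Complex.normSq_eq_norm_sq ((n : ℂ) * v)
      rw [norm_mul, Complex.norm_natCast, hnv, Complex.normSq_apply] at this
      linarith
    rw [sq, Complex.mul_re]
    rw [hu] at h1 ⊢
    linear_combination -h1
  have hRre := (abs_le.1 ((Complex.abs_re_le_norm (R / (n * v))).trans hRb)).1
  rw [hdecomp, Complex.add_re, Complex.add_re, Complex.add_re, Complex.one_re,
    Complex.re_ofReal_mul, Complex.re_ofReal_mul, hu, hu2]
  have hb1 : 0.2589 ≤ (1 - m) / 2 * δ ∧ (1 - m) / 2 * δ ≤ 0.26745 := by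
    constructor <;> nlinarith
  have hc : 0.15136 ≤ (1 - m) * (1 - 2 * m) / 6 ∧ (1 - m) * (1 - 2 * m) / 6 ≤ 1 / 6 := by
    constructor <;> nlinarith
  have hd : 0.2859 ≤ δ ^ 2 ∧ δ ^ 2 ≤ 0.28612 := by
    constructor <;> nlinarith
  have hb2 : 0.04327 ≤ (1 - m) * (1 - 2 * m) / 6 * δ ^ 2 ∧
      (1 - m) * (1 - 2 * m) / 6 * δ ^ 2 ≤ 0.0477 := by
    constructor
    · refine le_trans ?_ (mul_le_mul hc.1 hd.1 (by norm_num) (by linarith))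
      norm_num
    · refine (mul_le_mul hc.2 hd.2 (by positivity) (by norm_num)).trans ?_
      norm_num
  set b1 := (1 - m) / 2 * δ
  set b2 := (1 - m) * (1 - 2 * m) / 6 * δ ^ 2
  have e1 : (1 - m) / 2 * (δ * (1 - y)) = b1 - b1 * y := by simp only [b1]; ring
  have e2 : (1 - m) * (1 - 2 * m) / 6 * (δ ^ 2 * (1 - 4 * y + 2 * y ^ 2)) =
      b2 - 4 * (b2 * y) + 2 * (b2 * y ^ 2) := by simp only [b2]; ring
  rw [e1, e2]
  have f1 : b1 * y ≤ 0.26745 * y := mul_le_mul_of_nonneg_right hb1.2 hy0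
  have f2 : b2 * y ≤ 0.0477 * y := mul_le_mul_of_nonneg_right hb2.2 hy0
  have f3 : 0 ≤ b2 * y ^ 2 := mul_nonneg (by linarith) (sq_nonneg y)
  -- Constants: 1 + 0.2589 + 0.04327 - 0.0075 ≥ 1.294 and 0.26745 + 4 · 0.0477 ≤ 0.46; the term in
  -- y² is dropped.
  linarith

lemma exists_one_sub_eq_re (hδ0 : 0 < δ) (hnv : n * ‖v‖ = δ) :
    ∃ y : ℝ, 0 ≤ y ∧ y ≤ 2 ∧ n * v.re = δ * (1 - y) := by
  obtain ⟨h1, h2⟩ := abs_le.1 (Complex.abs_re_le_norm v)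
  have h3 : (n : ℝ) * v.re ≤ δ := hnv ▸ mul_le_mul_of_nonneg_left h2 n.cast_nonneg
  have h4 : -δ ≤ n * v.re := by
    rw [← hnv, ← mul_neg]
    exact mul_le_mul_of_nonneg_left h1 n.cast_nonneg
  refine ⟨1 - n * v.re / δ, ?_, ?_, by field_simp; ring⟩
  · linarith [(div_le_one hδ0).2 h3]
  · have := (le_div_iff₀ hδ0).2 (show -1 * δ ≤ n * v.re by linarith)
    linarith

/-- |1 + v|² = (1 + δ/n)² - 2(δ/n)y, and (1 + δ/n)² ≤ 2δ, so moving away from v = δ/n costs a factor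
e^(-y/n), that is e^(-y) after the n-th power. -/
lemma sq_pow_norm_one_add_le (hn : 32 ≤ n) (hδ1 : 0.5347 < δ) (hδ2 : δ < 0.5349)
    (hv : ‖v‖ = δ / n) {y : ℝ} (hy0 : 0 ≤ y) (hy2 : y ≤ 2) (hre : n * v.re = δ * (1 - y)) :
    (‖1 + v‖ ^ n) ^ 2 ≤ ((1 + δ / n) ^ n) ^ 2 * (1 - 0.4 * y) := by
  have hn32 : (32 : ℝ) ≤ n := by exact_mod_cast hn
  have hn0 : (n : ℝ) ≠ 0 := by linarith
  have hδ0 : 0 < δ := by linarith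
  have hδn : δ / n ≤ 0.0168 := by
    rw [div_le_iff₀ (by linarith)]
    linarith
  have hδn0 : 0 < δ / n := by positivity
  have hvre : v.re = δ / n * (1 - y) := by
    field_simp
    linarith
  have hsq : ‖1 + v‖ ^ 2 = (1 + δ / n) ^ 2 - 2 * (δ / n) * y := by
    have h2 : v.re ^ 2 + v.im ^ 2 = (δ / n) ^ 2 := by
      rw [← hv, ← Complex.normSq_eq_norm_sq, Complex.normSq_apply]
      ring
    rw [← Complex.normSq_eq_norm_sq, Complex.normSq_apply]
    simp only [Complex.add_re, Complex.add_im, Complex.one_re, Complex.one_im]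
    rw [hvre] at h2 ⊢
    linear_combination h2
  have hle : ‖1 + v‖ ^ 2 ≤ (1 + δ / n) ^ 2 * exp (-y / n) := by
    rw [hsq]
    have h3 : 1 - y / n ≤ exp (-y / n) := by
      have := add_one_le_exp (-y / n)
      rw [neg_div] at this ⊢
      linarith
    have h4 : (1 + δ / n) ^ 2 * (1 - y / n) ≤ (1 + δ / n) ^ 2 * exp (-y / n) :=
      mul_le_mul_of_nonneg_left h3 (by positivity)
    refine le_trans ?_ h4
    have h5 : (1 + δ / n) ^ 2 ≤ 1.0339 := by nlinarith
    have h6 : (1 + δ / n) ^ 2 * (y / n) ≤ 1.0339 * (y / n) :=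
      mul_le_mul_of_nonneg_right h5 (by positivity)
    have h7 : 1.0339 * (y / n) ≤ 2 * (δ / n) * y := by
      rw [show 2 * (δ / n) * y = (2 * δ) * (y / n) by ring]
      exact mul_le_mul_of_nonneg_right (by linarith) (by positivity)
    linarith
  have hexp : exp (-y) ≤ 1 - 0.4 * y := by
    have h8 := quadratic_le_exp_of_nonneg hy0
    rw [exp_neg]
    refine (inv_anti₀ (by positivity) h8).trans ?_
    rw [inv_le_iff_one_le_mul₀ (by positivity)]
    nlinarith [mul_nonneg hy0 (sub_nonneg.2 hy2), mul_nonneg (mul_nonneg hy0 hy0) (sub_nonneg.2 hy2)]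
  calc (‖1 + v‖ ^ n) ^ 2 = (‖1 + v‖ ^ 2) ^ n := by rw [← pow_mul, ← pow_mul, mul_comm]
    _ ≤ ((1 + δ / n) ^ 2 * exp (-y / n)) ^ n := pow_le_pow_left₀ (by positivity) hle n
    _ = ((1 + δ / n) ^ n) ^ 2 * exp (-y) := by
      rw [mul_pow, ← pow_mul, ← pow_mul, mul_comm 2 n, ← exp_nat_mul]
      congr 2
      field_simp
    _ ≤ _ := mul_le_mul_of_nonneg_left hexp (by positivity)

/-- With ρ = |1 + v|, the right side is the tail denominator |z| - |z|^n. It is smallest at ρ = 1 +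
δ/n because n r^n ρ^n exceeds rρ; Bernoulli's inequality replaces the derivative. -/
lemma sub_pow_le_sub_pow {r ρ : ℝ} (hn : 32 ≤ n) (hr1 : r < 1) (hδ1 : 0.5347 < δ)
    (hδ2 : δ < 0.5349) (hρ0 : 1 - δ / n ≤ ρ) (hρ1 : ρ ≤ 1 + δ / n) (hκ0 : 0 ≤ r ^ n)
    (hlow : 4.68 ≤ n * r ^ n) :
    r * (1 + δ / n) - r ^ n * (1 + δ / n) ^ n ≤ r * ρ - r ^ n * ρ ^ n := by
  have hn32 : (32 : ℝ) ≤ n := by exact_mod_cast hn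
  have hn0 : (n : ℝ) ≠ 0 := by linarith
  have hδ0 : 0 < δ := by linarith
  have hδn : δ / n ≤ 0.0168 := by
    rw [div_le_iff₀ (by linarith)]
    linarith
  have hδn0 : 0 < δ / n := by positivity
  have hρ : 0 < ρ := by linarith
  have hE : 1 - δ ≤ ρ ^ n := by
    have h := one_add_mul_sub_le_pow (show -1 ≤ ρ by linarith) n
    have h2 : (n : ℝ) * (1 - δ / n - 1) ≤ n * (ρ - 1) :=
      mul_le_mul_of_nonneg_left (by linarith) (by positivity)
    have h3 : (n : ℝ) * (1 - δ / n - 1) = -δ := by field_simp; ring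
    linarith
  have hB : ρ ^ n + n * ρ ^ n * ((1 + δ / n - ρ) / ρ) ≤ (1 + δ / n) ^ n := by
    have h := one_add_mul_sub_le_pow (a := (1 + δ / n) / ρ)
      (by linarith [show 0 < (1 + δ / n) / ρ by positivity]) n
    have h4 := mul_le_mul_of_nonneg_left h (pow_nonneg hρ.le n)
    rw [← mul_pow, mul_div_cancel₀ _ hρ.ne'] at h4
    refine le_trans (le_of_eq ?_) h4
    field_simp
  have h5 : 0 ≤ (1 + δ / n - ρ) / ρ := div_nonneg (by linarith) hρ.le
  have h6 : 4.68 * 0.465 ≤ (n * r ^ n) * ρ ^ n :=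
    mul_le_mul hlow (by linarith) (by norm_num) (by positivity)
  have h7 : r * (1 + δ / n - ρ) ≤ r ^ n * (n * ρ ^ n * ((1 + δ / n - ρ) / ρ)) := by
    have h8 : r * ρ ≤ (n * r ^ n) * ρ ^ n := by nlinarith
    calc r * (1 + δ / n - ρ) = r * ρ * ((1 + δ / n - ρ) / ρ) := by field_simp
      _ ≤ (n * r ^ n) * ρ ^ n * ((1 + δ / n - ρ) / ρ) := mul_le_mul_of_nonneg_right h8 h5
      _ = _ := by ring
  have h9 := mul_le_mul_of_nonneg_left hB hκ0
  nlinarith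

end Circle

/-- The Rouché-type estimate on the circle `|z - z₁| = δ |z₁| / n`, with `z = z₁ (1 + v)`. -/
lemma re_parryUpper_div_pos {β r φ δ t : ℝ} {n : ℕ} {z₁ v : ℂ} (hβ1 : 1 < β)
    (hlt : β ^ (n - 2) * (β - 1) < 1) (hle : 1 ≤ β ^ (n - 1) * (β - 1)) (hn32 : 32 ≤ n)
    (hroot : -1 + z₁ + z₁ ^ n = 0) (hnorm : ‖z₁‖ = r) (hr0 : 0 < r) (hr1 : r < 1)
    (hzre : z₁.re = r * cos φ) (hzim : z₁.im = r * sin φ) (hlow : 4.68 ≤ n * r ^ n)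
    (hδ1 : 0.5347 < δ) (hδ2 : δ < 0.5349) (hδe : exp δ < 1.70711)
    (hD : 0 < r * (1 + δ / n) - r ^ n * (1 + δ / n) ^ n) (ht0 : 0 ≤ t)
    (ht : t ≤ r * (cos φ - r) / (n * (r ^ n) ^ 2))
    (hM : r ^ n * ((1 + δ / n) ^ n) ^ 2 <
      (1.294 + t) * (δ * (r * (1 + δ / n) - r ^ n * (1 + δ / n) ^ n)))
    (hv : ‖v‖ = δ / n) (hz1 : ‖z₁ * (1 + v)‖ < 1) :
    0 < (parryUpper β (z₁ * (1 + v)) / (n * z₁ ^ n * v)).re := by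
  have hnr : (32 : ℝ) ≤ n := by exact_mod_cast hn32
  have hn0 : (n : ℝ) ≠ 0 := by linarith
  have hnC : (n : ℂ) ≠ 0 := by exact_mod_cast hn0
  have hδ0 : 0 < δ := by linarith
  have hR : 0 < δ / n := by positivity
  have hκ0 : 0 < r ^ n := by positivity
  have hz0 : z₁ ≠ 0 := norm_pos_iff.1 (hnorm ▸ hr0)
  have hv0 : v ≠ 0 := norm_pos_iff.1 (by rw [hv]; exact hR)
  have hnv : n * ‖v‖ = δ := by rw [hv]; field_simp
  obtain ⟨y, hy0, hy2, hre⟩ := exists_one_sub_eq_re hδ0 hnv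
  have hG := re_one_add_pow_sub_one_div hn32 hδ1 hδ2 hδe hv hy0 hre
  have hE := sq_pow_norm_one_add_le hn32 hδ1 hδ2 hv hy0 hy2 hre
  have hρ0 : 1 - δ / n ≤ ‖1 + v‖ := by
    have := norm_sub_le_norm_add (1 : ℂ) v
    rw [norm_one, hv] at this
    exact this
  have hρ1 : ‖1 + v‖ ≤ 1 + δ / n := by
    have := norm_add_le (1 : ℂ) v
    rwa [norm_one, hv] at this
  have hDv := sub_pow_le_sub_pow hn32 hr1 hδ1 hδ2 hρ0 hρ1 hκ0.le hlow
  have htail := norm_parryUpper_sub_trinomial_le hβ1 (by omega) hlt hle hz1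
  set h := parryUpper β (z₁ * (1 + v)) - (-1 + z₁ * (1 + v) + (z₁ * (1 + v)) ^ n) with hh
  have hsplit : parryUpper β (z₁ * (1 + v)) / (n * z₁ ^ n * v) =
      (((n : ℝ)⁻¹ : ℝ) : ℂ) * (z₁ / z₁ ^ n) + ((1 + v) ^ n - 1) / (n * v) +
        h / (n * z₁ ^ n * v) := by
    rw [hh, mul_pow]
    push_cast
    field_simp
    linear_combination hroot
  have hterm : ((((n : ℝ)⁻¹ : ℝ) : ℂ) * (z₁ / z₁ ^ n)).re =
      r * (cos φ - r) / (n * (r ^ n) ^ 2) := by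
    have hz1n : z₁ ^ n = 1 - z₁ := by linear_combination hroot
    have hns : Complex.normSq (1 - z₁) = (r ^ n) ^ 2 := by
      rw [← hz1n, Complex.normSq_eq_norm_sq, norm_pow, hnorm]
    rw [Complex.re_ofReal_mul, hz1n, Complex.div_re, hns]
    simp only [Complex.sub_re, Complex.sub_im, Complex.one_re, Complex.one_im, hzre, hzim]
    field_simp
    linear_combination -r * sin_sq_add_cos_sq φ
  have htailre : -((1.294 + t) * (1 - 0.4 * y)) < (h / (n * z₁ ^ n * v)).re := by
    have hz0' : 0 < ‖z₁ * (1 + v)‖ := by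
      rw [norm_mul, hnorm]
      have : δ / n ≤ 0.5 := by
        rw [div_le_iff₀ (by linarith)]
        linarith
      exact mul_pos hr0 (by linarith)
    have hDpos := hD.trans_le hDv
    have hpow : ‖z₁ * (1 + v)‖ ^ n = r ^ n * ‖1 + v‖ ^ n := by
      rw [norm_mul, hnorm, mul_pow]
    have htail' : ‖h‖ ≤ (r ^ n * ‖1 + v‖ ^ n) ^ 2 / (r * ‖1 + v‖ - r ^ n * ‖1 + v‖ ^ n) := by
      refine htail.trans (le_of_eq ?_)
      have e1 : ‖z₁ * (1 + v)‖ ^ (n - 1) * ‖z₁ * (1 + v)‖ = r ^ n * ‖1 + v‖ ^ n := by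
        rw [← pow_succ, show n - 1 + 1 = n by omega, hpow]
      have e2 : ‖z₁ * (1 + v)‖ ^ (2 * n - 1) * ‖z₁ * (1 + v)‖ =
          (r ^ n * ‖1 + v‖ ^ n) ^ 2 := by
        rw [← pow_succ, show 2 * n - 1 + 1 = n * 2 by omega, pow_mul, hpow]
      have e3 : r * ‖1 + v‖ = ‖z₁ * (1 + v)‖ := by rw [norm_mul, hnorm]
      rw [← e2, ← e1, e3, ← mul_div_mul_right _ _ hz0'.ne']
      congr 1
      ring
    have hbound : ‖h / (n * z₁ ^ n * v)‖ < (1.294 + t) * (1 - 0.4 * y) := by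
      rw [norm_div, norm_mul, norm_mul, norm_pow, hnorm, Complex.norm_natCast,
        mul_right_comm, hnv, div_lt_iff₀ (by positivity)]
      refine htail'.trans_lt ?_
      rw [div_lt_iff₀ hDpos]
      have hy' : 0 < 1 - 0.4 * y := by linarith
      calc (r ^ n * ‖1 + v‖ ^ n) ^ 2 = (r ^ n) ^ 2 * (‖1 + v‖ ^ n) ^ 2 := by ring
        _ ≤ (r ^ n) ^ 2 * (((1 + δ / n) ^ n) ^ 2 * (1 - 0.4 * y)) :=
          mul_le_mul_of_nonneg_left hE (by positivity)
        _ = r ^ n * (1 - 0.4 * y) * (r ^ n * ((1 + δ / n) ^ n) ^ 2) := by ring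
        _ < r ^ n * (1 - 0.4 * y) * ((1.294 + t) *
            (δ * (r * (1 + δ / n) - r ^ n * (1 + δ / n) ^ n))) :=
          mul_lt_mul_of_pos_left hM (by positivity)
        _ ≤ r ^ n * (1 - 0.4 * y) * ((1.294 + t) *
            (δ * (r * ‖1 + v‖ - r ^ n * ‖1 + v‖ ^ n))) := by gcongr
        _ = _ := by ring
    linarith [(abs_le.1 (Complex.abs_re_le_norm (h / (n * z₁ ^ n * v)))).1]
  rw [hsplit, Complex.add_re, Complex.add_re, hterm]
  -- What remains is (0.4 · 1.294 - 0.46)y + 0.4ty ≥ 0.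
  have hty := mul_nonneg ht0 (show 0 ≤ 0.4 * y by positivity)
  linarith

/-! ### Return to the variable z. -/

theorem mainTheorem3 (β : ℝ) (hβ : IsSalem β) (n : ℕ) (hn : dynamicalDegree β = n)
    (hn32 : 32 ≤ n) :
    ∃ ω ∈ Metric.ball (firstRoot n) (Real.pi * ‖firstRoot n‖ / (n * aMax)),
      parryUpper β ω = 0 ∧ analyticOrderAt (parryUpper β) ω = 1 ∧ ω.im ≠ 0 ∧ ‖ω‖ < 1 ∧
        ∀ z ∈ Metric.ball (firstRoot n) (Real.pi * ‖firstRoot n‖ / (n * aMax)),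
          parryUpper β z = 0 → z = ω := by
  obtain ⟨hβ1, hlt, hle⟩ := pow_bounds_of_dynamicalDegree hn (by omega)
  have hβ2 := lt_two_of_pow_mul_lt hβ1 hlt
  have hdiff := differentiableOn_parryUpper hβ1 hβ2
  obtain ⟨hδ1, hδ2⟩ := pi_div_aMax_bounds
  have hδe := exp_pi_div_aMax_lt
  have haMax := exp_pi_div_aMax.2
  obtain ⟨r, γ, φ, hr0, hr1, hγ0, hγ, hφ, hz, h1, h2⟩ := firstRoot_polar (n := n) (by omega)
  have hroot := (isFirstRoot_firstRoot (n := n) (by omega)).1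
  have hlow := pow_lower hn32 hr0 hγ0 hγ hφ h1 h2
  obtain ⟨hκ, hE1, hD, t, ht0, ht, hM⟩ := firstRoot_numeric hn32 hr0 hr1 hγ0 hγ hφ h1 h2 hδ1 hδ2 hδe
  have hsin := sin_phi_lower hn32 hγ0 hγ hφ
  have hrad : Real.pi * ‖firstRoot n‖ / (n * aMax) = ‖firstRoot n‖ * (Real.pi / aMax / n) := by
    field_simp
  rw [hrad]
  have hnr : (32 : ℝ) ≤ n := by exact_mod_cast hn32
  have hn0 : (n : ℝ) ≠ 0 := by linarith
  have hnC : (n : ℂ) ≠ 0 := by exact_mod_cast hn0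
  set z₁ := firstRoot n
  set δ := Real.pi / aMax
  have hnorm : ‖z₁‖ = r := by
    rw [hz, norm_mul, Complex.norm_exp_ofReal_mul_I, Complex.norm_real, mul_one,
      Real.norm_of_nonneg hr0.le]
  have hzre : z₁.re = r * cos φ := by
    rw [hz, Complex.re_ofReal_mul, Complex.exp_ofReal_mul_I_re]
  have hzim : z₁.im = r * sin φ := by
    rw [hz, Complex.im_ofReal_mul, Complex.exp_ofReal_mul_I_im]
  have hz0 : z₁ ≠ 0 := norm_pos_iff.1 (hnorm ▸ hr0)
  have hδ0 : 0 < δ := by linarith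
  have hR : 0 < δ / n := by positivity
  have hκ0 : 0 < r ^ n := by positivity
  -- The closed disk stays in the open unit disk, where the series converges: the n-th power is at
  -- most 0.166 · 1.70711.
  have hrad1 : r * (1 + δ / n) < 1 := by
    have h3 : (r * (1 + δ / n)) ^ n < 1 := by
      rw [mul_pow]
      nlinarith
    by_contra! h
    have := one_le_pow₀ h (n := n)
    linarith
  have hnormz : ∀ v : ℂ, ‖v‖ ≤ δ / n → ‖z₁ * (1 + v)‖ < 1 := by
    intro v hv
    rw [norm_mul, hnorm]
    refine lt_of_le_of_lt (mul_le_mul_of_nonneg_left ?_ hr0.le) hrad1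
    refine (norm_add_le _ _).trans ?_
    rw [norm_one]
    linarith
  have hfd : ∀ z : ℂ, ‖z‖ < 1 → DifferentiableAt ℂ (parryUpper β) z := fun z hz =>
    hdiff.differentiableAt (Metric.isOpen_ball.mem_nhds (mem_ball_zero_iff.2 hz))
  have hmd : ∀ v : ℂ, HasDerivAt (fun v : ℂ => z₁ * (1 + v)) z₁ v := fun v => by
    simpa using ((hasDerivAt_id v).const_add (1 : ℂ)).const_mul z₁
  have hFd : ∀ v : ℂ, ‖v‖ ≤ δ / n → HasDerivAt (fun v => parryUpper β (z₁ * (1 + v)))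
      (deriv (parryUpper β) (z₁ * (1 + v)) * z₁) v := fun v hv =>
    HasDerivAt.comp (h₂ := parryUpper β) v (hfd _ (hnormz v hv)).hasDerivAt (hmd v)
  obtain ⟨v, hv, hv0, hvd, hvu⟩ := existsUnique_simple_zero_of_re_pos hR
    (F := fun v => parryUpper β (z₁ * (1 + v))) (A := n * z₁ ^ n)
    (fun v hv => (hFd v (mem_closedBall_zero_iff.1 hv)).differentiableAt)
    (mul_ne_zero hnC (pow_ne_zero _ hz0)) (fun v hv => by
      have hv := mem_sphere_zero_iff_norm.1 hv
      exact re_parryUpper_div_pos hβ1 hlt hle hn32 hroot hnorm hr0 hr1 hzre hzim hlow hδ1 hδ2 hδe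
        hD ht0 ht hM hv (hnormz v hv.le))
  rw [mem_ball_zero_iff] at hv
  have hωd : deriv (parryUpper β) (z₁ * (1 + v)) ≠ 0 := by
    rw [(hFd v hv.le).deriv] at hvd
    exact left_ne_zero_of_mul hvd
  refine ⟨z₁ * (1 + v), ?_, hv0, ?_, ?_, hnormz v hv.le, fun z hzb hz0' => ?_⟩
  · rw [mem_ball_iff_norm, show z₁ * (1 + v) - z₁ = z₁ * v by ring, norm_mul]
    exact mul_lt_mul_of_pos_left hv (norm_pos_iff.2 hz0)
  · have han : AnalyticAt ℂ (parryUpper β) (z₁ * (1 + v)) :=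
      hdiff.analyticAt (Metric.isOpen_ball.mem_nhds (mem_ball_zero_iff.2 (hnormz v hv.le)))
    exact han.analyticOrderAt_eq_one_of_zero_deriv_ne_zero hv0 hωd
  · have him : (z₁ * (1 + v)).im = r * sin φ + (z₁ * v).im := by
      rw [mul_add, mul_one, Complex.add_im, hzim]
    have h3 : ‖z₁ * v‖ < r * (δ / n) := by
      rw [norm_mul, hnorm]
      exact mul_lt_mul_of_pos_left hv hr0
    have h4 := (abs_le.1 (Complex.abs_im_le_norm (z₁ * v))).1
    -- As n sin φ ≥ 4.68 > δ, the disk does not meet the real axis.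
    have h5 : δ / n ≤ sin φ := by
      rw [div_le_iff₀ (by linarith)]
      linarith
    have h6 : r * (δ / n) ≤ r * sin φ := mul_le_mul_of_nonneg_left h5 hr0.le
    rw [him]
    exact ne_of_gt (by linarith)
  · have hzv : z = z₁ * (1 + (z - z₁) / z₁) := by field_simp; ring
    have hmem : (z - z₁) / z₁ ∈ Metric.ball (0 : ℂ) (δ / n) := by
      rw [mem_ball_zero_iff, norm_div, div_lt_iff₀ (norm_pos_iff.2 hz0), mul_comm]
      exact mem_ball_iff_norm.1 hzb
    have := hvu _ hmem (by rw [← hzv]; exact hz0')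
    rw [hzv, this]
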